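/- Let $G=\widetilde{\mathrm{Isom}(\mathbb{R}^2)}$ be the universal covering group of the (identity component of the) isometry group of the Euclidean plane, i.e. $\mathbb{R}^3$ with coordinates $(x,y,\theta)$, where $(w,\theta)(w',\theta')=(w+\mathrm{Rot}_\theta w',\,\theta+\theta')$ for $w=(x,y)$. For a Riemannian metric $g$ on $G$ with Ricci tensor $R_{ij}$ and scalar curvature $R$, let $$C_{ij}=g_{ik}\,\varepsilon^{klm}\Big(\nabla_lR_{mj}-\tfrac14\nabla_lR\,g_{mj}\Big)$$ be the Cotton–York tensor, where $\varepsilon^{klm}=\eta^{klm}/\sqrt{\det g}$ and $\eta^{klm}$ is the completely antisymmetric symbol with $\eta^{123}=1$; put $|C_2|_g^2=g^{ip}g^{jq}C_{ij}C_{pq}$, and for compact $K\subset G$ let $C_K(g)=\int_K|C_2|_g\,d\mu_g$, where $d\mu_g$ is the volume element of $g$. Let $g_0$ be any left-invariant Riemannian metric on $G$. Then $g_0$ has a Milnor frame, i.e. a frame of left-invariant vector fields $F_1,F_2,F_3$ with $[F_2,F_3]=-2F_1$, $[F_3,F_1]=-2F_2$, $[F_1,F_2]=0$ and $$g_0=A_0\,\omega^1\otimes\omega^1+B_0\,\omega^2\otimes\omega^2+C_0\,\omega^3\otimes\omega^3,\qquad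 A_0,B_0,C_0>0,$$ where $\omega^1,\omega^2,\omega^3$ is the dual coframe. There is a solution $g(t)$, $0\le t<\infty$, of the Ricci flow $\frac{\partial}{\partial t}g=-2\,\mathrm{Ric}_{g}$ with $g(0)=g_0$ that consists of left-invariant metrics, and any solution on an interval $[0,T)$ that starts at $g_0$ and consists of left-invariant metrics agrees with it on $[0,T)$. For every Milnor frame of $g_0$ as above and every compact set $K\subset G$: 1. If $A_0\neq B_0$, then $C_K(g(t))\to0$ as $t\to\infty$, and if moreover $K$ has positive volume, then $t\mapsto C_K(g(t))$ is strictly decreasing on $[0,\infty)$. 2. If $A_0=B_0$, then $C_K(g(t))=0$ for all $t\ge0$. -/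

import Mathlib

open Set Filter Topology MeasureTheory
open scoped ContDiff

noncomputable section

namespace CottonFlow

/-! ### The universal cover of the isometry group of the plane

As a manifold it is `ℝ³`, with global coordinates `p = (x, y, θ)`. The point `(x, y, θ)` lies over
the rigid motion `z ↦ exp (i θ) z + (x + i y)` of the plane. -/

/-- The underlying manifold `ℝ³`, in global coordinates `(x, y, θ)`. -/
abbrev Pt : Type := Fin 3 → ℝ

/-- The product of the universal cover of `Isom(ℝ²)`:
`(w, θ) (w', θ') = (w + rotation by θ of w', θ + θ')`. -/
def mul (a p : Pt) : Pt :=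
  ![a 0 + (Real.cos (a 2) * p 0 - Real.sin (a 2) * p 1),
    a 1 + (Real.sin (a 2) * p 0 + Real.cos (a 2) * p 1),
    a 2 + p 2]

/-- The inverse of `(w, θ)`. -/
def inv (a : Pt) : Pt :=
  ![-(Real.cos (a 2) * a 0 + Real.sin (a 2) * a 1),
    Real.sin (a 2) * a 0 - Real.cos (a 2) * a 1,
    -a 2]

/-- The group structure on `ℝ³` (not the pointwise product of functions `Fin 3 → ℝ`). -/
@[reducible]
def groupStructure : Group Pt :=
  @Group.ofLeftAxioms Pt ⟨mul⟩ ⟨inv⟩ ⟨fun _ => 0⟩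
    (fun a b c => by
      change mul (mul a b) c = mul a (mul b c)
      funext i
      fin_cases i <;> simp [mul, Real.cos_add, Real.sin_add] <;> ring)
    (fun a => by
      change mul (fun _ => 0) a = a
      funext i
      fin_cases i <;> simp [mul])
    (fun a => by
      change mul (inv a) a = fun _ => 0
      funext i
      fin_cases i <;> simp [mul, inv])

/-- The rigid motion of the plane below a point of the cover. -/
def rigidMotion (a : Pt) (z : ℂ) : ℂ :=
  Complex.exp (a 2 * Complex.I) * z + (a 0 + a 1 * Complex.I)

theorem rigidMotion_isometry (a : Pt) : Isometry (rigidMotion a) := by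
  refine Isometry.of_dist_eq fun z w => ?_
  simp only [rigidMotion, dist_eq_norm, add_sub_add_right_eq_sub, ← mul_sub, norm_mul,
    Complex.norm_exp_ofReal_mul_I, one_mul]

theorem rigidMotion_mul (a b : Pt) : rigidMotion (mul a b) = rigidMotion a ∘ rigidMotion b := by
  funext z
  simp only [rigidMotion, mul, Function.comp, Matrix.cons_val]
  push_cast
  rw [add_mul, Complex.exp_add, Complex.exp_mul_I (a 2 : ℂ)]
  linear_combination (-(Complex.sin (a 2) * b 1)) * Complex.I_sq

/-- Every orientation preserving rigid motion is covered. -/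
theorem exists_rigidMotion (c w : ℂ) (hc : ‖c‖ = 1) : ∃ a, rigidMotion a = fun z => c * z + w := by
  refine ⟨![w.re, w.im, c.arg], ?_⟩
  funext z
  have h := Complex.norm_mul_exp_arg_mul_I c
  rw [hc, Complex.ofReal_one, one_mul] at h
  simp [rigidMotion, h, Complex.re_add_im]

/-- The fibres are the cosets of the discrete subgroup `{(0, 0, 2 π n)}`. -/
theorem rigidMotion_eq_iff (a b : Pt) : rigidMotion a = rigidMotion b ↔
    a 0 = b 0 ∧ a 1 = b 1 ∧ ∃ n : ℤ, a 2 = b 2 + n * (2 * Real.pi) := by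
  constructor
  · intro h
    have h0 := congrFun h 0
    have h1 := congrFun h 1
    simp only [rigidMotion, mul_zero, zero_add, mul_one] at h0 h1
    have hr := congrArg Complex.re h0
    have hi := congrArg Complex.im h0
    simp at hr hi
    rw [h0, add_left_inj, Complex.exp_eq_exp_iff_exists_int] at h1
    obtain ⟨n, hn⟩ := h1
    refine ⟨hr, hi, n, ?_⟩
    have := congrArg Complex.im hn
    simpa using this
  · rintro ⟨h0, h1, n, h2⟩
    funext z
    simp only [rigidMotion, h0, h1, h2]
    push_cast
    have : ((b 2 : ℂ) + n * (2 * Real.pi)) * Complex.I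
        = b 2 * Complex.I + n * (2 * Real.pi * Complex.I) := by ring
    rw [this, Complex.exp_add, Complex.exp_int_mul_two_pi_mul_I, mul_one]

/-! ### Riemannian geometry in the global coordinates

A metric is given by the matrix `g p i j = g_p(∂ᵢ, ∂ⱼ)`. -/

/-- A field of bilinear forms on `ℝ³`, by its components. -/
abbrev Form : Type := Pt → Matrix (Fin 3) (Fin 3) ℝ

/-- The value of a field of bilinear forms at the tangent vectors `u`, `v` at `p`. -/
def Form.app (T : Form) (p u v : Pt) : ℝ := ∑ i, ∑ j, T p i j * u i * v j

/-- Smooth Riemannian metrics. -/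
structure IsRiemannianMetric (g : Form) : Prop where
  smooth : ∀ i j, ContDiff ℝ ∞ fun p => g p i j
  posDef : ∀ p, (g p).PosDef

/-- The partial derivative `∂ᵢ f`. -/
def pd (i : Fin 3) (f : Pt → ℝ) (p : Pt) : ℝ := fderiv ℝ f p (Pi.single i 1)

/-- The Christoffel symbol `Γᵏᵢⱼ`. -/
def christoffel (g : Form) (k i j : Fin 3) (p : Pt) : ℝ :=
  (1 / 2) * ∑ l, (g p)⁻¹ k l *
    (pd i (fun q => g q j l) p + pd j (fun q => g q i l) p - pd l (fun q => g q i j) p)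

/-- The component of `∂ₗ` in `R(∂ᵢ, ∂ⱼ) ∂ₖ = ∇ᵢ ∇ⱼ ∂ₖ - ∇ⱼ ∇ᵢ ∂ₖ`. -/
def riemann (g : Form) (i j k l : Fin 3) (p : Pt) : ℝ :=
  pd i (christoffel g l j k) p - pd j (christoffel g l i k) p
    + ∑ m, (christoffel g l i m p * christoffel g m j k p
        - christoffel g l j m p * christoffel g m i k p)

/-- The Ricci tensor `Rⱼₖ`, the trace of `X ↦ R(X, ∂ⱼ) ∂ₖ`. -/
def ricci (g : Form) : Form := fun p j k => ∑ i, riemann g i j k i p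

/-- The scalar curvature. -/
def scalar (g : Form) (p : Pt) : ℝ := ∑ i, ∑ j, (g p)⁻¹ i j * ricci g p i j

/-- The covariant derivative `∇ₗ Tᵢⱼ` of a field of bilinear forms. -/
def covDeriv (g T : Form) (l i j : Fin 3) (p : Pt) : ℝ :=
  pd l (fun q => T q i j) p
    - ∑ n, (christoffel g n l i p * T p n j + christoffel g n l j p * T p i n)

/-- The completely antisymmetric symbol, with `eta 0 1 2 = 1`. -/
def eta (i j k : Fin 3) : ℝ :=
  (((i : ℕ) : ℝ) - ((j : ℕ) : ℝ)) * (((j : ℕ) : ℝ) - ((k : ℕ) : ℝ))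
    * (((k : ℕ) : ℝ) - ((i : ℕ) : ℝ)) / 2

/-- The Cotton-York tensor `Cᵢⱼ = gᵢₖ εᵏˡᵐ (∇ₗ Rₘⱼ - (1/4) ∇ₗ R gₘⱼ)`, `εᵏˡᵐ = ηᵏˡᵐ / √(det g)`. -/
def cottonYork (g : Form) : Form := fun p i j =>
  ∑ k, ∑ l, ∑ m, g p i k * (eta k l m / Real.sqrt (g p).det) *
    (covDeriv g (ricci g) l m j p - (1 / 4) * pd l (scalar g) p * g p m j)

/-- The pointwise norm `|T|_g`, with `|T|_g² = gⁱᵃ gʲᵇ Tᵢⱼ Tₐᵦ`. -/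
def tensorNorm (g T : Form) (p : Pt) : ℝ :=
  Real.sqrt (∑ i, ∑ j, ∑ a, ∑ b, (g p)⁻¹ i a * (g p)⁻¹ j b * T p i j * T p a b)

/-- The `L¹`-norm over `K` of the Cotton-York tensor, for the volume element
`√(det g) dx dy dθ` of `g`. -/
def cottonYorkL1 (K : Set Pt) (g : Form) : ℝ :=
  ∫ p in K, tensorNorm g (cottonYork g) p * Real.sqrt (g p).det

/-- `g t`, for `t` in the interval `I`, is a solution of the Ricci flow `∂g/∂t = -2 Ric`
(one-sided derivative at an endpoint that belongs to `I`). -/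
structure IsRicciFlowOn (I : Set ℝ) (g : ℝ → Form) : Prop where
  metric : ∀ t ∈ I, IsRiemannianMetric (g t)
  evolution : ∀ t ∈ I, ∀ p i j,
    HasDerivWithinAt (fun s => g s p i j) (-2 * ricci (g t) p i j) I t

/-! ### Left-invariant objects -/

/-- Left translations preserve the field of bilinear forms. -/
def IsLeftInvariant (g : Form) : Prop :=
  ∀ a p u v, g.app (mul a p) (fderiv ℝ (mul a) p u) (fderiv ℝ (mul a) p v) = g.app p u v

/-- Left translations preserve the vector field. -/
def IsLeftInvariantField (X : Pt → Pt) : Prop :=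
  ∀ a p, fderiv ℝ (mul a) p (X p) = X (mul a p)

/-- `F₁, F₂, F₃` (indexed by `0, 1, 2`) is a Milnor frame for `g`, with
`g = A ω¹ ⊗ ω¹ + B ω² ⊗ ω² + C ω³ ⊗ ω³` in the dual coframe: a left-invariant frame with
`[F₂, F₃] = -2 F₁`, `[F₃, F₁] = -2 F₂`, `[F₁, F₂] = 0`. -/
structure IsMilnorFrame (g : Form) (F : Fin 3 → Pt → Pt) (A B C : ℝ) : Prop where
  leftInvariant : ∀ i, IsLeftInvariantField (F i)
  bracket_23 : ∀ p, VectorField.lieBracket ℝ (F 1) (F 2) p = (-2 : ℝ) • F 0 p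
  bracket_31 : ∀ p, VectorField.lieBracket ℝ (F 2) (F 0) p = (-2 : ℝ) • F 1 p
  bracket_12 : ∀ p, VectorField.lieBracket ℝ (F 0) (F 1) p = 0
  linearIndependent : ∀ p, LinearIndependent ℝ fun i => F i p
  pos : 0 < A ∧ 0 < B ∧ 0 < C
  diagonal : ∀ p i j, g.app p (F i p) (F j p) = Matrix.diagonal ![A, B, C] i j

end CottonFlow

end

/-! Left translations are affine maps of `ℝ³` whose linear part is a rotation about the `θ`-axis. A
left-invariant tensor is therefore a constant array rotated by `rot θ`, and its only nonzero partial
derivative, the one along `θ`, acts on that array through `gen`. Rotations are orthogonal, have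
determinant one and fix the third axis, so Christoffel symbols, Ricci and Cotton-York tensors keep
this rotated shape, and curvature becomes algebra on a single matrix (`ricci_rot`,
`cottonYork_rot`).

Diagonalising the horizontal block by a rotation and completing squares puts the metric, up to that
rotation, in the form `A (dx - v dθ)² + B (dy - w dθ)² + C dθ²` (`exists_diagForm`). Ricci is
diagonal in the same coframe (`ricBase_diagForm`), so `v`, `w` and the angle stay fixed and the flow
reduces to `a' = -(a² - b²)/(bc)`, `b' = (a² - b²)/(ac)`, `c' = (a - b)²/(ab)`. The quantities `ab =
k²` and `c (a + b) = 2kκ` are conserved. For `a ≠ b` this gives the explicit solution `a, b = k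
(cosh y ± 1)/sinh y`, `c = κ tanh y`, where `y - tanh y` is affine in `t` with slope `4/κ`
(`isCoefficientFlow_param`). For `a = b` the metric is flat and stationary.

The measure `|C₂| dμ` is a constant multiple of Lebesgue measure, and the square of the constant is
a polynomial in `q = 1/sinh² y`, increasing for `q ≥ 0` and zero at `q = 0` (`density_param`). Since
`y` increases to infinity, strict decay to zero follows. Uniqueness is ODE uniqueness for the metric
at the origin (`ricciFlow_unique`), and `IsMilnorFrame.eq_iff` carries the dichotomy to an arbitrary
Milnor frame. -/

open Set Filter Topology MeasureTheory
open scoped ContDiff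

noncomputable section

namespace CottonFlow

/-! ### Tensors of rotation type -/

/-- The rotation of `ℝ³` by the angle `ψ` about the last axis. -/
def rot (ψ : ℝ) : Matrix (Fin 3) (Fin 3) ℝ :=
  !![Real.cos ψ, -Real.sin ψ, 0; Real.sin ψ, Real.cos ψ, 0; 0, 0, 1]

/-- The infinitesimal generator of `rot`. -/
def gen : Matrix (Fin 3) (Fin 3) ℝ := !![0, -1, 0; 1, 0, 0; 0, 0, 0]

theorem rot_transpose_mul (ψ : ℝ) : (rot ψ).transpose * rot ψ = 1 := by
  have := Real.sin_sq_add_cos_sq ψ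
  ext i j
  fin_cases i <;> fin_cases j <;> simp [rot, Matrix.mul_apply, Fin.sum_univ_three] <;> grind

theorem rot_mul_transpose (ψ : ℝ) : rot ψ * (rot ψ).transpose = 1 :=
  mul_eq_one_comm.mp (rot_transpose_mul ψ)

theorem rot_inv (ψ : ℝ) : (rot ψ)⁻¹ = (rot ψ).transpose :=
  Matrix.inv_eq_left_inv (rot_transpose_mul ψ)

theorem rot_det (ψ : ℝ) : (rot ψ).det = 1 := by
  have := Real.sin_sq_add_cos_sq ψ
  simp [rot, Matrix.det_fin_three]
  grind

theorem rot_zero : rot 0 = 1 := by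
  ext i j
  fin_cases i <;> fin_cases j <;> simp [rot]

theorem rot_add (a b : ℝ) : rot (a + b) = rot a * rot b := by
  ext i j
  fin_cases i <;> fin_cases j <;>
    simp [rot, Matrix.mul_apply, Fin.sum_univ_three, Real.cos_add, Real.sin_add] <;> ring

theorem hasDerivAt_rot (ψ : ℝ) (i a : Fin 3) :
    HasDerivAt (fun s => rot s i a) ((rot ψ * gen) i a) ψ := by
  fin_cases i <;> fin_cases a <;>
    simp [rot, gen, Matrix.mul_apply, Fin.sum_univ_three, Real.hasDerivAt_cos, Real.hasDerivAt_sin,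
      hasDerivAt_const, (Real.hasDerivAt_sin ψ).fun_neg]

/-- Contracting two vectors rotated by the same rotation. -/
theorem rot_contract (ψ : ℝ) (f h : Fin 3 → ℝ) :
    ∑ l, (∑ a, rot ψ l a * f a) * (∑ b, rot ψ l b * h b) = ∑ a, f a * h a := by
  have := Real.sin_sq_add_cos_sq ψ
  simp [rot, Fin.sum_univ_three]
  grind

/-- The action on tensors of rank two. -/
def act₂ (Q M : Matrix (Fin 3) (Fin 3) ℝ) : Matrix (Fin 3) (Fin 3) ℝ := Q * M * Q.transpose

theorem act₂_apply (Q M : Matrix (Fin 3) (Fin 3) ℝ) (i j : Fin 3) :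
    act₂ Q M i j = ∑ a, Q i a * ∑ b, Q j b * M a b := by
  simp [act₂, Matrix.mul_apply, Fin.sum_univ_three]
  ring

theorem act₂_apply_swap (Q M : Matrix (Fin 3) (Fin 3) ℝ) (i j : Fin 3) :
    act₂ Q M i j = ∑ b, Q j b * ∑ a, Q i a * M a b := by
  simp [act₂, Matrix.mul_apply, Fin.sum_univ_three]
  ring

theorem act₂_inv (ψ : ℝ) (M : Matrix (Fin 3) (Fin 3) ℝ) :
    (act₂ (rot ψ) M)⁻¹ = act₂ (rot ψ) M⁻¹ := by
  have h : ((rot ψ).transpose)⁻¹ = rot ψ := Matrix.inv_eq_left_inv (rot_mul_transpose ψ)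
  rw [act₂, Matrix.mul_inv_rev, Matrix.mul_inv_rev, h, rot_inv, act₂, Matrix.mul_assoc]

theorem act₂_det (ψ : ℝ) (M : Matrix (Fin 3) (Fin 3) ℝ) : (act₂ (rot ψ) M).det = M.det := by
  simp [act₂, rot_det]

/-- Arrays with three indices in `Fin 3`. -/
abbrev Array₃ : Type := Fin 3 → Fin 3 → Fin 3 → ℝ

/-- The action on tensors of rank three. -/
def act₃ (Q : Matrix (Fin 3) (Fin 3) ℝ) (T : Array₃) : Array₃ := fun k i j =>
  ∑ a, Q k a * ∑ b, Q i b * ∑ c, Q j c * T a b c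

theorem act₃_apply_312 (Q : Matrix (Fin 3) (Fin 3) ℝ) (T : Array₃) (k i j : Fin 3) :
    act₃ Q T k i j = ∑ c, Q j c * ∑ a, Q k a * ∑ b, Q i b * T a b c := by
  simp [act₃, Fin.sum_univ_three]
  ring

/-- The angular derivative of a rotated tensor of rank two. -/
def ang₂ (M : Matrix (Fin 3) (Fin 3) ℝ) : Matrix (Fin 3) (Fin 3) ℝ := gen * M - M * gen

/-- The angular derivative of a rotated tensor of rank three. -/
def ang₃ (T : Array₃) : Array₃ := fun k i j =>
  (∑ a, gen k a * T a i j) + (∑ a, gen i a * T k a j) + ∑ a, gen j a * T k i a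

/-- The differential of a function of the angle only. -/
theorem pd_of_angle {f : ℝ → ℝ} {f' : ℝ} {φ : ℝ} {p : Pt} (h : HasDerivAt f f' (p 2 + φ))
    (l : Fin 3) : pd l (fun q => f (q 2 + φ)) p = if l = 2 then f' else 0 := by
  have h2 : HasFDerivAt (fun q : Pt => q 2 + φ)
      (ContinuousLinearMap.proj (R := ℝ) (φ := fun _ : Fin 3 => ℝ) 2) p :=
    (hasFDerivAt_apply (𝕜 := ℝ) (2 : Fin 3) p).add_const φ
  have h3 := h.comp_hasFDerivAt p h2
  rw [pd, show (fun q : Pt => f (q 2 + φ)) = f ∘ fun q : Pt => q 2 + φ from rfl, h3.fderiv]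
  fin_cases l <;> simp

theorem hasDerivAt_act₂ (M : Matrix (Fin 3) (Fin 3) ℝ) (ψ : ℝ) (i j : Fin 3) :
    HasDerivAt (fun s => act₂ (rot s) M i j) (act₂ (rot ψ) (ang₂ M) i j) ψ := by
  have h : HasDerivAt (fun s => ∑ a, rot s i a * ∑ b, rot s j b * M a b)
      (∑ a, ((rot ψ * gen) i a * (∑ b, rot ψ j b * M a b)
        + rot ψ i a * ∑ b, (rot ψ * gen) j b * M a b)) ψ :=
    HasDerivAt.fun_sum fun a _ => (hasDerivAt_rot ψ i a).mul
      (HasDerivAt.fun_sum fun b _ => (hasDerivAt_rot ψ j b).mul_const _)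
  simp only [act₂_apply]
  convert h using 1
  simp only [ang₂, Matrix.sub_apply, Matrix.mul_apply, Fin.sum_univ_three]
  simp [gen]
  ring

theorem hasDerivAt_act₃ (T : Array₃) (ψ : ℝ) (k i j : Fin 3) :
    HasDerivAt (fun s => act₃ (rot s) T k i j) (act₃ (rot ψ) (ang₃ T) k i j) ψ := by
  have h : HasDerivAt (fun s => ∑ a, rot s k a * ∑ b, rot s i b * ∑ c, rot s j c * T a b c)
      (∑ a, ((rot ψ * gen) k a * (∑ b, rot ψ i b * ∑ c, rot ψ j c * T a b c)
        + rot ψ k a * ∑ b, ((rot ψ * gen) i b * (∑ c, rot ψ j c * T a b c)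
          + rot ψ i b * ∑ c, (rot ψ * gen) j c * T a b c))) ψ :=
    HasDerivAt.fun_sum fun a _ => (hasDerivAt_rot ψ k a).mul
      (HasDerivAt.fun_sum fun b _ => (hasDerivAt_rot ψ i b).mul
        (HasDerivAt.fun_sum fun c _ => (hasDerivAt_rot ψ j c).mul_const _))
  simp only [act₃]
  convert h using 1
  simp [ang₃, gen, Matrix.mul_apply, Fin.sum_univ_three]
  ring

/-- The components of the differential of a rotated tensor of rank two. -/
def grad₂ (M : Matrix (Fin 3) (Fin 3) ℝ) : Array₃ := fun l i j => if l = 2 then ang₂ M i j else 0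

/-- Only the derivative along `θ` survives, and `rot` fixes the third axis, so the derivative index
may be rotated too at no cost. -/
theorem pd_act₂ (M : Matrix (Fin 3) (Fin 3) ℝ) (φ : ℝ) (p : Pt) (l i j : Fin 3) :
    pd l (fun q => act₂ (rot (q 2 + φ)) M i j) p = act₃ (rot (p 2 + φ)) (grad₂ M) l i j := by
  rw [pd_of_angle (hasDerivAt_act₂ M (p 2 + φ) i j), act₂_apply]
  fin_cases l <;> simp [act₃, grad₂, rot, Fin.sum_univ_three]

theorem pd_act₃ (T : Array₃) (φ : ℝ) (p : Pt) (l k i j : Fin 3) :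
    pd l (fun q => act₃ (rot (q 2 + φ)) T k i j) p
      = if l = 2 then act₃ (rot (p 2 + φ)) (ang₃ T) k i j else 0 :=
  pd_of_angle (hasDerivAt_act₃ T (p 2 + φ) k i j) l

/-! ### Curvature of a rotated metric -/

/-- The Christoffel symbols of a rotated metric, at angle zero. -/
def christBase (M : Matrix (Fin 3) (Fin 3) ℝ) : Array₃ := fun k i j =>
  (1 / 2) * ∑ l, M⁻¹ k l * (grad₂ M i j l + grad₂ M j i l - grad₂ M l i j)

theorem christoffel_rot {g : Form} {M : Matrix (Fin 3) (Fin 3) ℝ} {φ : ℝ}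
    (hg : ∀ p, g p = act₂ (rot (p 2 + φ)) M) (k i j : Fin 3) (p : Pt) :
    christoffel g k i j p = act₃ (rot (p 2 + φ)) (christBase M) k i j := by
  simp only [christoffel, hg, act₂_inv, pd_act₂]
  generalize hψ : p 2 + φ = ψ
  have hX : ∀ l, act₃ (rot ψ) (grad₂ M) i j l + act₃ (rot ψ) (grad₂ M) j i l
      - act₃ (rot ψ) (grad₂ M) l i j = ∑ d, rot ψ l d * ∑ a, rot ψ i a * ∑ b, rot ψ j b *
        (grad₂ M a b d + grad₂ M b a d - grad₂ M d a b) := by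
    intro l
    simp [act₃, Fin.sum_univ_three]
    ring
  simp only [hX, act₂_apply_swap, rot_contract]
  simp [act₃, christBase, Fin.sum_univ_three]
  ring

/-- The Ricci tensor of a rotated metric, at angle zero. -/
def ricBase (M : Matrix (Fin 3) (Fin 3) ℝ) : Matrix (Fin 3) (Fin 3) ℝ := Matrix.of fun j k =>
  ang₃ (christBase M) 2 j k - (if j = 2 then ∑ i, ang₃ (christBase M) i i k else 0)
    + ∑ i, ∑ m, (christBase M i i m * christBase M m j k
        - christBase M i j m * christBase M m i k)

theorem act₃_trace (ψ : ℝ) (T : Array₃) (k : Fin 3) :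
    ∑ i, act₃ (rot ψ) T i i k = ∑ c, rot ψ k c * ∑ i, T i i c := by
  have h := Real.sin_sq_add_cos_sq ψ
  simp only [act₃_apply_312]
  rw [Finset.sum_comm]
  refine Finset.sum_congr rfl fun c _ => ?_
  rw [← Finset.mul_sum]
  congr 1
  simp [rot, Fin.sum_univ_three]
  grind

theorem act₃_trace_mul (ψ : ℝ) (T : Array₃) (j k : Fin 3) :
    ∑ i, ∑ m, act₃ (rot ψ) T i i m * act₃ (rot ψ) T m j k
      = act₂ (rot ψ) (Matrix.of fun a b => ∑ i, ∑ m, T i i m * T m a b) j k := by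
  rw [Finset.sum_comm]
  simp only [← Finset.sum_mul, act₃_trace]
  simp only [act₃, rot_contract]
  rw [act₂_apply]
  simp [Fin.sum_univ_three]
  ring

theorem act₃_mul_cross (ψ : ℝ) (T : Array₃) (j k : Fin 3) :
    ∑ i, ∑ m, act₃ (rot ψ) T i j m * act₃ (rot ψ) T m i k
      = act₂ (rot ψ) (Matrix.of fun a b => ∑ i, ∑ m, T i a m * T m i b) j k := by
  have h1 : ∀ i m, act₃ (rot ψ) T i j m
      = ∑ c, rot ψ m c * ∑ a, rot ψ i a * ∑ b, rot ψ j b * T a b c := fun i m =>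
    act₃_apply_312 _ _ _ _ _
  have h2 : ∀ i m, act₃ (rot ψ) T m i k
      = ∑ c, rot ψ m c * ∑ a, rot ψ i a * ∑ b, rot ψ k b * T c a b := fun i m => rfl
  simp only [h1, h2, rot_contract]
  rw [Finset.sum_comm]
  simp only [rot_contract]
  rw [act₂_apply]
  simp [Fin.sum_univ_three]
  ring

theorem ricci_rot {g : Form} {M : Matrix (Fin 3) (Fin 3) ℝ} {φ : ℝ}
    (hg : ∀ p, g p = act₂ (rot (p 2 + φ)) M) (p : Pt) :
    ricci g p = act₂ (rot (p 2 + φ)) (ricBase M) := by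
  have hΓ : ∀ k i j, christoffel g k i j
      = fun q => act₃ (rot (q 2 + φ)) (christBase M) k i j := fun k i j =>
    funext fun q => christoffel_rot hg k i j q
  ext j k
  simp only [ricci, riemann, hΓ, pd_act₃]
  generalize p 2 + φ = ψ
  generalize hT : christBase M = T
  have hlin : act₂ (rot ψ) (ricBase M) j k
      = act₂ (rot ψ) (Matrix.of (ang₃ T 2)) j k
        - act₂ (rot ψ) (Matrix.of fun a b => if a = 2 then ∑ i, ang₃ T i i b else 0) j k
        + (act₂ (rot ψ) (Matrix.of fun a b => ∑ i, ∑ m, T i i m * T m a b) j k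
          - act₂ (rot ψ) (Matrix.of fun a b => ∑ i, ∑ m, T i a m * T m i b) j k) := by
    have : ricBase M = (Matrix.of (ang₃ T 2)
        - Matrix.of (fun a b => if a = 2 then ∑ i, ang₃ T i i b else 0))
        + (Matrix.of (fun a b => ∑ i, ∑ m, T i i m * T m a b)
          - Matrix.of (fun a b => ∑ i, ∑ m, T i a m * T m i b)) := by
      ext a b
      simp [ricBase, hT, Finset.sum_sub_distrib]
    rw [this]
    simp only [act₂, Matrix.mul_add, Matrix.mul_sub, Matrix.add_mul, Matrix.sub_mul,
      Matrix.add_apply, Matrix.sub_apply]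
  rw [hlin, ← act₃_trace_mul, ← act₃_mul_cross]
  simp only [Finset.sum_add_distrib, Finset.sum_sub_distrib]
  congr 1
  congr 1
  · rw [Finset.sum_ite_eq' Finset.univ (2 : Fin 3)]
    rw [act₂_apply]
    simp [act₃, rot, Fin.sum_univ_three]
  · have : ∑ i, (if j = 2 then act₃ (rot ψ) (ang₃ T) i i k else 0)
        = if j = 2 then ∑ i, act₃ (rot ψ) (ang₃ T) i i k else 0 := by
      split_ifs <;> simp
    rw [this, act₃_trace, act₂_apply]
    fin_cases j <;> simp [rot, Fin.sum_univ_three]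

theorem scalar_rot {g : Form} {M : Matrix (Fin 3) (Fin 3) ℝ} {φ : ℝ}
    (hg : ∀ p, g p = act₂ (rot (p 2 + φ)) M) (p : Pt) :
    scalar g p = ∑ i, ∑ j, M⁻¹ i j * ricBase M i j := by
  simp only [scalar, ricci_rot hg, hg, act₂_inv]
  simp only [act₂_apply_swap, rot_contract]
  rw [Finset.sum_comm]
  simp only [rot_contract]
  exact Finset.sum_comm

/-- The covariant derivative of a rotated tensor for a rotated metric, at angle zero. -/
def covBase (M T : Matrix (Fin 3) (Fin 3) ℝ) : Array₃ := fun l i j =>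
  grad₂ T l i j - ∑ n, (christBase M n l i * T n j + christBase M n l j * T i n)

theorem covDeriv_rot {g T : Form} {M S : Matrix (Fin 3) (Fin 3) ℝ} {φ : ℝ}
    (hg : ∀ p, g p = act₂ (rot (p 2 + φ)) M) (hT : ∀ p, T p = act₂ (rot (p 2 + φ)) S)
    (l i j : Fin 3) (p : Pt) :
    covDeriv g T l i j p = act₃ (rot (p 2 + φ)) (covBase M S) l i j := by
  simp only [covDeriv, hT, pd_act₂, christoffel_rot hg]
  generalize p 2 + φ = ψ
  generalize hΓ : christBase M = Γ
  have h1 : ∑ n, act₃ (rot ψ) Γ n l i * act₂ (rot ψ) S n j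
      = act₃ (rot ψ) (fun a b c => ∑ n, Γ n a b * S n c) l i j := by
    simp only [act₃, act₂_apply, rot_contract]
    simp [Fin.sum_univ_three]
    ring
  have h2 : ∑ n, act₃ (rot ψ) Γ n l j * act₂ (rot ψ) S i n
      = act₃ (rot ψ) (fun a b c => ∑ n, Γ n a c * S b n) l i j := by
    simp only [act₃, act₂_apply_swap, rot_contract]
    simp [Fin.sum_univ_three]
    ring
  rw [Finset.sum_add_distrib, h1, h2]
  simp only [covBase, hΓ, act₃, Finset.sum_add_distrib, mul_sub, mul_add, Finset.sum_sub_distrib]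

/-- The Cotton-York tensor of a rotated metric, at angle zero. -/
def cottonBase (M : Matrix (Fin 3) (Fin 3) ℝ) : Matrix (Fin 3) (Fin 3) ℝ :=
  (Real.sqrt M.det)⁻¹ •
    (M * Matrix.of fun k j => ∑ l, ∑ m, eta k l m * covBase M (ricBase M) l m j)

/-- The antisymmetric symbol is invariant under rotations because their determinant is one. -/
theorem act₃_eta (ψ : ℝ) (T : Array₃) (k j : Fin 3) :
    ∑ l, ∑ m, eta k l m * act₃ (rot ψ) T l m j
      = act₂ (rot ψ) (Matrix.of fun k j => ∑ l, ∑ m, eta k l m * T l m j) k j := by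
  have h := Real.sin_sq_add_cos_sq ψ
  have hc : Real.cos ψ ^ 2 = 1 - Real.sin ψ ^ 2 := by linarith
  simp only [act₃_apply_312, act₂_apply_swap, Finset.mul_sum]
  simp only [Fin.sum_univ_three]
  fin_cases k <;> simp [eta, rot] <;> (ring_nf; try (rw [hc]; ring))

theorem cottonYork_rot {g : Form} {M : Matrix (Fin 3) (Fin 3) ℝ} {φ : ℝ}
    (hg : ∀ p, g p = act₂ (rot (p 2 + φ)) M) (p : Pt) :
    cottonYork g p = act₂ (rot (p 2 + φ)) (cottonBase M) := by
  -- The scalar curvature is a full contraction, hence constant on the group, and its gradient term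
  -- drops out.
  have hs : ∀ l, pd l (scalar g) p = 0 := by
    intro l
    rw [show scalar g = fun _ => _ from funext fun q => scalar_rot hg q]
    simp [pd]
  ext i j
  simp only [cottonYork, hs, covDeriv_rot hg (ricci_rot hg), hg, act₂_det]
  generalize p 2 + φ = ψ
  have hsum : ∀ k, ∑ l, ∑ m, act₂ (rot ψ) M i k * (eta k l m / Real.sqrt M.det) *
      (act₃ (rot ψ) (covBase M (ricBase M)) l m j - 1 / 4 * 0 * act₂ (rot ψ) M m j)
      = (Real.sqrt M.det)⁻¹ * (act₂ (rot ψ) M i k *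
        ∑ l, ∑ m, eta k l m * act₃ (rot ψ) (covBase M (ricBase M)) l m j) := by
    intro k
    simp only [Finset.mul_sum]
    refine Finset.sum_congr rfl fun l _ => Finset.sum_congr rfl fun m _ => ?_
    ring
  simp only [hsum, act₃_eta, ← Finset.mul_sum, ← Matrix.mul_apply]
  rw [cottonBase, act₂, act₂, act₂]
  have hQ := rot_transpose_mul ψ
  simp only [Matrix.mul_smul, Matrix.smul_mul, Matrix.smul_apply, smul_eq_mul, Matrix.mul_assoc]
  rw [← Matrix.mul_assoc (rot ψ).transpose (rot ψ), hQ, Matrix.one_mul]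

theorem tensorNorm_eq_trace (g T : Form) (p : Pt) : tensorNorm g T p
    = Real.sqrt (((g p)⁻¹.transpose * T p * (g p)⁻¹ * (T p).transpose).trace) := by
  rw [tensorNorm]
  congr 1
  simp [Matrix.trace, Matrix.mul_apply, Fin.sum_univ_three]
  ring

theorem tensorNorm_rot {g T : Form} {M S : Matrix (Fin 3) (Fin 3) ℝ} {φ : ℝ}
    (hg : ∀ p, g p = act₂ (rot (p 2 + φ)) M) (hT : ∀ p, T p = act₂ (rot (p 2 + φ)) S) (p : Pt) :
    tensorNorm g T p
      = Real.sqrt ((M⁻¹.transpose * S * M⁻¹ * S.transpose).trace) := by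
  rw [tensorNorm_eq_trace, hg, hT, act₂_inv]
  generalize p 2 + φ = ψ
  congr 1
  have hQ := rot_transpose_mul ψ
  have hQ' : ∀ X, (rot ψ).transpose * (rot ψ * X) = X := fun X => by
    rw [← Matrix.mul_assoc, hQ, Matrix.one_mul]
  simp only [act₂, Matrix.transpose_mul, Matrix.transpose_transpose, Matrix.mul_assoc, hQ']
  -- The inner rotations cancel in pairs; cyclicity of the trace brings the two outer ones together.
  rw [Matrix.trace_mul_comm]
  simp only [Matrix.mul_assoc, hQ, Matrix.mul_one]

/-! ### The curvature of a diagonal metric -/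

/-- The form `A (dx - v dθ)² + B (dy - w dθ)² + C dθ²`. -/
def diagForm (v w A B C : ℝ) : Matrix (Fin 3) (Fin 3) ℝ :=
  !![A, 0, -(A * v); 0, B, -(B * w); -(A * v), -(B * w), A * v ^ 2 + B * w ^ 2 + C]

theorem diagForm_det (v w A B C : ℝ) : (diagForm v w A B C).det = A * B * C := by
  simp [diagForm, Matrix.det_fin_three]
  ring

theorem diagForm_inv (v w : ℝ) {A B C : ℝ} (hA : A ≠ 0) (hB : B ≠ 0) (hC : C ≠ 0) :
    (diagForm v w A B C)⁻¹ = !![A⁻¹ + v ^ 2 * C⁻¹, v * w * C⁻¹, v * C⁻¹;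
      v * w * C⁻¹, B⁻¹ + w ^ 2 * C⁻¹, w * C⁻¹; v * C⁻¹, w * C⁻¹, C⁻¹] := by
  apply Matrix.inv_eq_left_inv
  ext i j
  fin_cases i <;> fin_cases j <;> simp [diagForm, Matrix.mul_apply, Fin.sum_univ_three] <;>
    field_simp <;> ring

theorem ang₂_diagForm (v w A B C : ℝ) : ang₂ (diagForm v w A B C)
    = !![0, A - B, B * w; A - B, 0, -(A * v); B * w, -(A * v), 0] := by
  ext i j
  fin_cases i <;> fin_cases j <;> simp [ang₂, gen, diagForm]
  ring

/-- The Christoffel symbols of `diagForm`. -/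
def christDiag (v w A B C : ℝ) : Array₃ :=
  ![!![0, -(v * (A - B) / (2 * C)), v * w * (A - B) / (2 * C);
      -(v * (A - B) / (2 * C)), 0, (A - B) * (A⁻¹ + v ^ 2 * C⁻¹) / 2;
      v * w * (A - B) / (2 * C), (A - B) * (A⁻¹ + v ^ 2 * C⁻¹) / 2,
        B * w / A - v ^ 2 * w * (A - B) / C],
    !![0, -(w * (A - B) / (2 * C)), (A - B) * (B⁻¹ + w ^ 2 * C⁻¹) / 2;
      -(w * (A - B) / (2 * C)), 0, v * w * (A - B) / (2 * C);
      (A - B) * (B⁻¹ + w ^ 2 * C⁻¹) / 2, v * w * (A - B) / (2 * C),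
        -(A * v / B) - v * w ^ 2 * (A - B) / C],
    !![0, -((A - B) / (2 * C)), w * (A - B) / (2 * C);
      -((A - B) / (2 * C)), 0, v * (A - B) / (2 * C);
      w * (A - B) / (2 * C), v * (A - B) / (2 * C), -(v * w * (A - B) / C)]]

theorem christBase_diagForm (v w : ℝ) {A B C : ℝ} (hA : A ≠ 0) (hB : B ≠ 0) (hC : C ≠ 0) :
    christBase (diagForm v w A B C) = christDiag v w A B C := by
  funext k i j
  simp only [christBase, grad₂, ang₂_diagForm, diagForm_inv v w hA hB hC, Fin.sum_univ_three]
  fin_cases k <;> fin_cases i <;> fin_cases j <;> simp [christDiag] <;> (try field_simp) <;>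
    (try ring)

/-- The frame dual to `dx - v dθ`, `dy - w dθ`, `dθ` has brackets independent of `v` and `w`, so
these enter only through the coframe. Ricci being diagonal there is what makes the flow preserve the
shape of the metric. -/
theorem ricBase_diagForm (v w : ℝ) {A B C : ℝ} (hA : A ≠ 0) (hB : B ≠ 0) (hC : C ≠ 0) :
    ricBase (diagForm v w A B C) = diagForm v w ((A ^ 2 - B ^ 2) / (2 * B * C))
      ((B ^ 2 - A ^ 2) / (2 * A * C)) (-((A - B) ^ 2 / (2 * A * B))) := by
  ext j k
  simp only [ricBase, christBase_diagForm v w hA hB hC, ang₃, Matrix.of_apply, Fin.sum_univ_three]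
  fin_cases j <;> fin_cases k <;> simp [christDiag, gen, diagForm] <;> field_simp <;> ring

theorem cottonBase_diagForm (v w : ℝ) {A B C : ℝ} (hA : A ≠ 0) (hB : B ≠ 0) (hC : C ≠ 0) :
    cottonBase (diagForm v w A B C) = (Real.sqrt (A * B * C))⁻¹ •
      diagForm v w (-((A - B) * (2 * A ^ 2 + A * B + B ^ 2) / (2 * B * C)))
        ((A - B) * (A ^ 2 + A * B + 2 * B ^ 2) / (2 * A * C))
        ((A - B) ^ 2 * (A + B) / (2 * A * B)) := by
  rw [cottonBase, diagForm_det]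
  congr 1
  ext k j
  rw [Matrix.mul_apply]
  simp only [covBase, ricBase_diagForm v w hA hB hC, christBase_diagForm v w hA hB hC,
    Matrix.of_apply, grad₂, ang₂_diagForm, Fin.sum_univ_three]
  fin_cases k <;> fin_cases j <;> simp [christDiag, eta, diagForm] <;> field_simp <;> ring

theorem diagForm_trace_norm (v w : ℝ) {A B C : ℝ} (hA : A ≠ 0) (hB : B ≠ 0) (hC : C ≠ 0)
    (r a b c : ℝ) :
    ((diagForm v w A B C)⁻¹.transpose * (r • diagForm v w a b c) * (diagForm v w A B C)⁻¹ *
      (r • diagForm v w a b c).transpose).trace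
        = r ^ 2 * (a ^ 2 / A ^ 2 + b ^ 2 / B ^ 2 + c ^ 2 / C ^ 2) := by
  -- Both mixed tensors are the same upper triangular matrix, so the trace of the product is the sum
  -- of the squared diagonal ratios.
  have h : (diagForm v w A B C)⁻¹.transpose * diagForm v w a b c
      = !![a / A, 0, v * (c / C - a / A); 0, b / B, w * (c / C - b / B); 0, 0, c / C] := by
    rw [diagForm_inv v w hA hB hC]
    ext i j
    fin_cases i <;> fin_cases j <;> simp [diagForm, Matrix.mul_apply, Fin.sum_univ_three] <;>
      field_simp <;> ring
  have h' : (diagForm v w A B C)⁻¹ * (diagForm v w a b c).transpose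
      = !![a / A, 0, v * (c / C - a / A); 0, b / B, w * (c / C - b / B); 0, 0, c / C] := by
    rw [diagForm_inv v w hA hB hC]
    ext i j
    fin_cases i <;> fin_cases j <;> simp [diagForm, Matrix.mul_apply, Fin.sum_univ_three] <;>
      field_simp <;> ring
  rw [Matrix.mul_assoc, Matrix.transpose_smul, Matrix.mul_smul, Matrix.mul_smul, h, h']
  simp [Matrix.trace, Fin.sum_univ_three]
  ring

/-- The square of the `L¹`-density of the Cotton-York tensor of a diagonal metric. -/
def density (A B C : ℝ) : ℝ :=
  (A - B) ^ 2 * (3 * (A ^ 2 + B ^ 2) ^ 2 + 3 * (A * B) * (A ^ 2 + B ^ 2) - 2 * (A * B) ^ 2)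
    / (2 * (A * B) ^ 2 * C ^ 2)

theorem cottonYork_density {g : Form} {v w A B C φ : ℝ} (hA : 0 < A) (hB : 0 < B) (hC : 0 < C)
    (hg : ∀ p, g p = act₂ (rot (p 2 + φ)) (diagForm v w A B C)) (p : Pt) :
    tensorNorm g (cottonYork g) p * Real.sqrt (g p).det = Real.sqrt (density A B C) := by
  have hABC : 0 < A * B * C := by positivity
  rw [tensorNorm_rot hg (cottonYork_rot hg), cottonBase_diagForm v w hA.ne' hB.ne' hC.ne',
    diagForm_trace_norm v w hA.ne' hB.ne' hC.ne', hg, act₂_det, diagForm_det,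
    ← Real.sqrt_mul' _ hABC.le]
  congr 1
  rw [inv_pow, Real.sq_sqrt hABC.le, density]
  field_simp
  ring

theorem cottonYorkL1_eq {g : Form} {v w A B C φ : ℝ} (hA : 0 < A) (hB : 0 < B) (hC : 0 < C)
    (hg : ∀ p, g p = act₂ (rot (p 2 + φ)) (diagForm v w A B C)) (K : Set Pt) :
    cottonYorkL1 K g = (volume K).toReal * Real.sqrt (density A B C) := by
  simp only [cottonYorkL1, cottonYork_density hA hB hC hg]
  simp [Measure.real]

/-! ### The flow of the diagonal coefficients -/

theorem hasDerivAt_sub_tanh (y : ℝ) :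
    HasDerivAt (fun y => y - Real.tanh y) (Real.tanh y ^ 2) y := by
  have hc := (Real.cosh_pos y).ne'
  have h := (hasDerivAt_id y).sub ((Real.hasDerivAt_sinh y).div (Real.hasDerivAt_cosh y) hc)
  have hf : (fun y => y - Real.tanh y) = id - (Real.sinh / Real.cosh) := by
    funext z
    simp [Real.tanh_eq_sinh_div_cosh]
  rw [hf]
  refine h.congr_deriv ?_
  rw [Real.tanh_eq_sinh_div_cosh]
  field_simp
  ring

theorem strictMono_sub_tanh : StrictMono fun y : ℝ => y - Real.tanh y := by
  have hcont : Continuous fun y : ℝ => y - Real.tanh y :=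
    continuous_iff_continuousAt.2 fun y => (hasDerivAt_sub_tanh y).continuousAt
  have hpos : ∀ y : ℝ, y ≠ 0 → 0 < deriv (fun y => y - Real.tanh y) y := by
    intro y hy
    rw [(hasDerivAt_sub_tanh y).deriv, Real.tanh_eq_sinh_div_cosh]
    have := (Real.cosh_pos y).ne'
    have := Real.sinh_ne_zero.2 hy
    positivity
  -- The derivative `tanh²` vanishes only at `0`, so the two half-lines are treated separately and
  -- glued.
  refine StrictMonoOn.Iic_union_Ici (a := 0)
    (strictMonoOn_of_deriv_pos (convex_Iic 0) hcont.continuousOn fun y hy => ?_)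
    (strictMonoOn_of_deriv_pos (convex_Ici 0) hcont.continuousOn fun y hy => ?_)
  · rw [interior_Iic] at hy
    exact hpos y (ne_of_lt hy)
  · rw [interior_Ici] at hy
    exact hpos y (ne_of_gt hy)

theorem surjective_sub_tanh : Function.Surjective fun y : ℝ => y - Real.tanh y := by
  have hcont : Continuous fun y : ℝ => y - Real.tanh y :=
    continuous_iff_continuousAt.2 fun y => (hasDerivAt_sub_tanh y).continuousAt
  refine hcont.surjective ?_ ?_
  · refine tendsto_atTop_mono (fun y => ?_) (tendsto_atTop_add_const_right atTop (-1 : ℝ) tendsto_id)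
    have := Real.tanh_lt_one y
    simp only [id]
    linarith
  · refine tendsto_atBot_mono (fun y => ?_) (tendsto_atBot_add_const_right atBot (1 : ℝ) tendsto_id)
    have := Real.neg_one_lt_tanh y
    simp only [id]
    linarith

/-- The map `y ↦ y - tanh y`, as an order isomorphism. -/
def subTanh : ℝ ≃o ℝ :=
  StrictMono.orderIsoOfSurjective _ strictMono_sub_tanh surjective_sub_tanh

theorem subTanh_apply (y : ℝ) : subTanh y = y - Real.tanh y := rfl

theorem subTanh_symm_pos {x : ℝ} (hx : 0 < x) : 0 < subTanh.symm x := by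
  rw [← subTanh.lt_iff_lt, OrderIso.apply_symm_apply, subTanh_apply]
  simpa using hx

theorem hasDerivAt_subTanh_symm {x : ℝ} (hx : 0 < x) :
    HasDerivAt subTanh.symm (Real.tanh (subTanh.symm x) ^ 2)⁻¹ x := by
  have hy := subTanh_symm_pos hx
  refine HasDerivAt.of_local_left_inverse (f := fun y => y - Real.tanh y)
    subTanh.symm.continuous.continuousAt (hasDerivAt_sub_tanh _) ?_
    (Eventually.of_forall fun z => subTanh.apply_symm_apply z)
  have := (Real.cosh_pos (subTanh.symm x)).ne'
  have := Real.sinh_ne_zero.2 hy.ne'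
  rw [Real.tanh_eq_sinh_div_cosh]
  positivity

/-- The evolution of the coefficients of a diagonal metric under the Ricci flow. -/
structure IsCoefficientFlow (a b c : ℝ → ℝ) : Prop where
  pos : ∀ t, 0 ≤ t → 0 < a t ∧ 0 < b t ∧ 0 < c t
  deriv_a : ∀ t, 0 ≤ t → HasDerivAt a (-2 * ((a t ^ 2 - b t ^ 2) / (2 * b t * c t))) t
  deriv_b : ∀ t, 0 ≤ t → HasDerivAt b (-2 * ((b t ^ 2 - a t ^ 2) / (2 * a t * c t))) t
  deriv_c : ∀ t, 0 ≤ t → HasDerivAt c (-2 * (-((a t - b t) ^ 2 / (2 * a t * b t)))) t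

theorem isCoefficientFlow_const {A C : ℝ} (hA : 0 < A) (hC : 0 < C) :
    IsCoefficientFlow (fun _ => A) (fun _ => A) (fun _ => C) where
  pos _ _ := ⟨hA, hA, hC⟩
  deriv_a t _ := by simpa using hasDerivAt_const t A
  deriv_b t _ := by simpa using hasDerivAt_const t A
  deriv_c t _ := by simpa using hasDerivAt_const t C

/-- The parameter of the explicit solution. -/
def param (κ y₀ t : ℝ) : ℝ := subTanh.symm (4 / κ * t + subTanh y₀)

theorem subTanh_pos {y : ℝ} (hy : 0 < y) : 0 < subTanh y := by
  have : subTanh 0 < subTanh y := subTanh.lt_iff_lt.2 hy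
  simpa [subTanh_apply] using this

theorem param_zero (κ y₀ : ℝ) : param κ y₀ 0 = y₀ := by simp [param]

theorem param_pos {κ y₀ t : ℝ} (hκ : 0 < κ) (hy : 0 < y₀) (ht : 0 ≤ t) : 0 < param κ y₀ t := by
  have := subTanh_pos hy
  exact subTanh_symm_pos (by positivity)

theorem strictMono_param {κ : ℝ} (hκ : 0 < κ) (y₀ : ℝ) : StrictMono (param κ y₀) := by
  intro s t h
  refine subTanh.symm.lt_iff_lt.2 ?_
  have : 0 < 4 / κ := by positivity
  nlinarith

theorem tendsto_param {κ : ℝ} (hκ : 0 < κ) (y₀ : ℝ) : Tendsto (param κ y₀) atTop atTop :=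
  subTanh.symm.tendsto_atTop.comp
    (tendsto_atTop_add_const_right _ _ (tendsto_id.const_mul_atTop (by positivity)))

/-- Differentiating `y - tanh y = 4t/κ + const` gives `y' tanh² y = 4/κ`. Positivity of `y` keeps
away from the critical point of `y - tanh y`. -/
theorem hasDerivAt_param {κ y₀ t : ℝ} (hκ : 0 < κ) (hy : 0 < y₀) (ht : 0 ≤ t) :
    HasDerivAt (param κ y₀) (4 / κ * (Real.cosh (param κ y₀ t) / Real.sinh (param κ y₀ t)) ^ 2) t := by
  have := subTanh_pos hy
  have h : HasDerivAt (fun t => 4 / κ * t + subTanh y₀) (4 / κ) t := by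
    simpa using ((hasDerivAt_id t).const_mul (4 / κ)).add_const (subTanh y₀)
  have h1 := (hasDerivAt_subTanh_symm (x := 4 / κ * t + subTanh y₀) (by positivity)).comp t h
  refine h1.congr_deriv ?_
  rw [Real.tanh_eq_sinh_div_cosh, param]
  field_simp

/-- The explicit solution: with `y = param κ y₀ t`, the coefficients are
`k (cosh y ± 1) / sinh y` and `κ tanh y`. -/
theorem isCoefficientFlow_param {k κ y₀ σ : ℝ} (hk : 0 < k) (hκ : 0 < κ) (hy : 0 < y₀)
    (hσ : σ = 1 ∨ σ = -1) :
    IsCoefficientFlow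
      (fun t => k * (Real.cosh (param κ y₀ t) + σ) / Real.sinh (param κ y₀ t))
      (fun t => k * (Real.cosh (param κ y₀ t) - σ) / Real.sinh (param κ y₀ t))
      (fun t => κ * Real.sinh (param κ y₀ t) / Real.cosh (param κ y₀ t)) := by
  have key : ∀ t, 0 ≤ t → 0 < Real.sinh (param κ y₀ t) ∧ 0 < Real.cosh (param κ y₀ t) - σ ∧
      0 < Real.cosh (param κ y₀ t) + σ := by
    intro t ht
    have h0 := param_pos hκ hy ht
    have h1 := Real.one_lt_cosh.2 h0.ne'
    refine ⟨Real.sinh_pos_iff.2 h0, ?_, ?_⟩ <;> rcases hσ with rfl | rfl <;> linarith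
  constructor
  · intro t ht
    obtain ⟨h1, h2, h3⟩ := key t ht
    have := Real.cosh_pos (param κ y₀ t)
    refine ⟨?_, ?_, ?_⟩ <;> positivity
  all_goals
    intro t ht
    obtain ⟨h1, h2, h3⟩ := key t ht
    have h4 := Real.cosh_pos (param κ y₀ t)
    have hp := hasDerivAt_param hκ hy ht
    have hS := hp.sinh
    have hC := hp.cosh
    have hcs := Real.cosh_sq (param κ y₀ t)
    have hne : Real.sinh (param κ y₀ t) ≠ 0 := h1.ne'
    have hne' : Real.cosh (param κ y₀ t) ≠ 0 := h4.ne'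
    have hσ2 : σ ^ 2 = 1 := by rcases hσ with rfl | rfl <;> norm_num
  · refine (((hC.add_const σ).const_mul k).fun_div hS hne).congr_deriv ?_
    generalize Real.cosh (param κ y₀ t) = c at *
    generalize Real.sinh (param κ y₀ t) = s at *
    have h2' := h2.ne'
    field_simp
    grind
  · refine (((hC.sub_const σ).const_mul k).fun_div hS hne).congr_deriv ?_
    generalize Real.cosh (param κ y₀ t) = c at *
    generalize Real.sinh (param κ y₀ t) = s at *
    have h3' := h3.ne'
    field_simp
    grind
  · refine ((hS.const_mul κ).fun_div hC hne').congr_deriv ?_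
    generalize Real.cosh (param κ y₀ t) = c at *
    generalize Real.sinh (param κ y₀ t) = s at *
    have h3' := h3.ne'
    have h2' := h2.ne'
    field_simp
    grind

/-- The density along the explicit solution. -/
theorem density_param {k κ y σ : ℝ} (hk : 0 < k) (hκ : 0 < κ) (hy : 0 < y) (hσ : σ = 1 ∨ σ = -1) :
    density (k * (Real.cosh y + σ) / Real.sinh y) (k * (Real.cosh y - σ) / Real.sinh y)
        (κ * Real.sinh y / Real.cosh y)
      = 8 * k ^ 2 / κ ^ 2 * ((Real.sinh y ^ 2)⁻¹ * (1 + (Real.sinh y ^ 2)⁻¹) *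
        (12 * ((Real.sinh y ^ 2)⁻¹) ^ 2 + 15 * (Real.sinh y ^ 2)⁻¹ + 4)) := by
  have hs : Real.sinh y ≠ 0 := (Real.sinh_pos_iff.2 hy).ne'
  have hc : Real.cosh y ≠ 0 := (Real.cosh_pos y).ne'
  have hcs := Real.cosh_sq y
  have hσ2 : σ ^ 2 = 1 := by rcases hσ with rfl | rfl <;> norm_num
  generalize Real.cosh y = c at *
  generalize Real.sinh y = s at *
  -- The density sees the first two coefficients only through their product, squared difference and
  -- sum of squares, so `σ` enters only as `σ² = 1`.
  have hAB : k * (c + σ) / s * (k * (c - σ) / s) = k ^ 2 := by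
    field_simp
    grind
  have hsub : k * (c + σ) / s - k * (c - σ) / s = 2 * k * σ / s := by
    field_simp
    ring
  have hsq : (k * (c + σ) / s) ^ 2 + (k * (c - σ) / s) ^ 2 = 4 * k ^ 2 / s ^ 2 + 2 * k ^ 2 := by
    field_simp
    grind
  have hcc : (κ * s / c) ^ 2 = κ ^ 2 * s ^ 2 / (s ^ 2 + 1) := by
    rw [← hcs]
    ring
  have : s ^ 2 + 1 ≠ 0 := by positivity
  rw [density, hAB, hsub, hsq, hcc, show (2 * k * σ / s) ^ 2 = 4 * k ^ 2 / s ^ 2 by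
    rw [div_pow, mul_pow, hσ2]; ring]
  field_simp
  ring

theorem strictMonoOn_density_polynomial :
    StrictMonoOn (fun q : ℝ => q * (1 + q) * (12 * q ^ 2 + 15 * q + 4)) (Ici 0) := by
  intro q hq r hr hqr
  have hq0 : 0 ≤ q := hq
  have hr0 : 0 < r := lt_of_le_of_lt hq0 hqr
  simp only
  gcongr

/-- Every unequal pair of coefficients lies on an explicit solution. -/
theorem exists_param {A B C : ℝ} (hA : 0 < A) (hB : 0 < B) (hC : 0 < C) (hAB : A ≠ B) :
    ∃ k κ y σ : ℝ, 0 < k ∧ 0 < κ ∧ 0 < y ∧ (σ = 1 ∨ σ = -1) ∧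
      k * (Real.cosh y + σ) / Real.sinh y = A ∧ k * (Real.cosh y - σ) / Real.sinh y = B ∧
      κ * Real.sinh y / Real.cosh y = C := by
  obtain ⟨σ, hσ, hd⟩ : ∃ σ : ℝ, (σ = 1 ∨ σ = -1) ∧ 0 < σ * (A - B) := by
    rcases lt_or_gt_of_ne hAB with h | h
    · exact ⟨-1, Or.inr rfl, by linarith⟩
    · exact ⟨1, Or.inl rfl, by linarith⟩
  have hσ2 : σ ^ 2 = 1 := by rcases hσ with rfl | rfl <;> norm_num
  -- Here `D = |A - B|`. On the explicit solution the product of the first two coefficients is `k²`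
  -- and their difference is `2kσ/sinh y`, which forces `k = √(AB)` and `sinh y = 2k/D`.
  generalize hD : σ * (A - B) = D at hd
  have hAB' : A - B = σ * D := by rw [← hD, ← mul_assoc, ← sq, hσ2, one_mul]
  have hk : 0 < Real.sqrt (A * B) := Real.sqrt_pos.2 (by positivity)
  have hk2 : Real.sqrt (A * B) ^ 2 = A * B := Real.sq_sqrt (by positivity)
  generalize Real.sqrt (A * B) = k at *
  have hs := Real.sinh_arsinh (2 * k / D)
  have hy : 0 < Real.arsinh (2 * k / D) := Real.arsinh_pos_iff.2 (by positivity)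
  have hc : Real.cosh (Real.arsinh (2 * k / D)) = (A + B) / D := by
    rw [Real.cosh_arsinh]
    rw [show 1 + (2 * k / D) ^ 2 = ((A + B) / D) ^ 2 by
      field_simp
      rw [hk2, ← hD, mul_pow, hσ2]
      ring]
    exact Real.sqrt_sq (by positivity)
  -- The value of `κ` is `C coth y`, the conserved quantity `C (A + B)` divided by `2k`.
  refine ⟨k, C * (A + B) / (2 * k), _, σ, hk, by positivity, hy, hσ, ?_, ?_, ?_⟩
  · rw [hs, hc]
    field_simp
    linarith
  · rw [hs, hc]
    field_simp
    linarith
  · rw [hs, hc]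
    field_simp

/-! ### Left-invariant metrics and fields -/

theorem mul_eq (a p : Pt) : mul a p = a + (rot (a 2)).mulVec p := by
  funext i
  fin_cases i <;> simp [mul, rot, dotProduct, Fin.sum_univ_three]
  ring

theorem mul_zero_right (a : Pt) : mul a 0 = a := by simp [mul_eq]

theorem fderiv_mul (a p u : Pt) : fderiv ℝ (mul a) p u = (rot (a 2)).mulVec u := by
  have h : HasFDerivAt (mul a) (Matrix.mulVecLin (rot (a 2))).toContinuousLinearMap p := by
    have : mul a = fun p => a + (Matrix.mulVecLin (rot (a 2))).toContinuousLinearMap p := by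
      funext q
      simp [mul_eq]
    rw [this]
    exact (ContinuousLinearMap.hasFDerivAt _).const_add a
  rw [h.fderiv]
  simp

theorem app_eq (T : Form) (p u v : Pt) : T.app p u v = u ⬝ᵥ (T p).mulVec v := by
  simp [Form.app, Matrix.mulVec, dotProduct, Fin.sum_univ_three]
  ring

theorem app_rot {g : Form} {M : Matrix (Fin 3) (Fin 3) ℝ} {φ : ℝ}
    (hg : ∀ p, g p = act₂ (rot (p 2 + φ)) M) (p u v : Pt) :
    g.app p ((rot (p 2 + φ)).mulVec u) ((rot (p 2 + φ)).mulVec v) = u ⬝ᵥ M.mulVec v := by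
  rw [app_eq, hg, act₂, Matrix.mulVec_mulVec, Matrix.mul_assoc, rot_transpose_mul, Matrix.mul_one,
    ← Matrix.mulVec_mulVec, Matrix.dotProduct_mulVec, Matrix.vecMul_mulVec, rot_transpose_mul,
    Matrix.vecMul_one]

theorem isLeftInvariant_of_rot {g : Form} {M : Matrix (Fin 3) (Fin 3) ℝ} {φ : ℝ}
    (hg : ∀ p, g p = act₂ (rot (p 2 + φ)) M) : IsLeftInvariant g := by
  intro a p u v
  have hu : ∀ u, u = (rot (p 2 + φ)).mulVec ((rot (p 2 + φ)).transpose.mulVec u) := fun u => by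
    rw [Matrix.mulVec_mulVec, rot_mul_transpose, Matrix.one_mulVec]
  have h2 : mul a p 2 = a 2 + p 2 := by simp [mul]
  have hl : ∀ u, (rot (a 2)).mulVec ((rot (p 2 + φ)).mulVec u) = (rot (mul a p 2 + φ)).mulVec u := by
    intro u
    rw [Matrix.mulVec_mulVec, ← rot_add, ← add_assoc, ← h2]
  rw [fderiv_mul, fderiv_mul, hu u, hu v, app_rot hg, hl, hl, app_rot hg]

/-- Left translation by `p` carries the origin to `p` with differential `rot (p 2)`, so the value at
the origin determines the form. -/
theorem IsLeftInvariant.eq_rot {g : Form} (hg : IsLeftInvariant g) (p : Pt) :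
    g p = act₂ (rot (p 2)) (g 0) := by
  have h : (rot (p 2)).transpose * g p * rot (p 2) = g 0 := by
    ext i j
    have h := hg p 0 (Pi.single i 1) (Pi.single j 1)
    rw [fderiv_mul, fderiv_mul, mul_zero_right, app_eq, app_eq] at h
    have e : ∀ N : Matrix (Fin 3) (Fin 3) ℝ, N i j = Pi.single i 1 ⬝ᵥ N.mulVec (Pi.single j 1) :=
      fun N => by simp
    rw [e (_ * _), e (g 0), ← h, ← Matrix.mulVec_mulVec, ← Matrix.mulVec_mulVec, Matrix.dotProduct_mulVec,
      Matrix.vecMul_transpose]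
  rw [act₂, ← h]
  have hQ := rot_mul_transpose (p 2)
  simp only [Matrix.mul_assoc, hQ, Matrix.mul_one]
  rw [← Matrix.mul_assoc, hQ, Matrix.one_mul]

theorem act₂_rot_add (a b : ℝ) (M : Matrix (Fin 3) (Fin 3) ℝ) :
    act₂ (rot (a + b)) M = act₂ (rot a) (act₂ (rot b) M) := by
  simp only [act₂, rot_add, Matrix.transpose_mul, Matrix.mul_assoc]

theorem posDef_act₂ {M : Matrix (Fin 3) (Fin 3) ℝ} (hM : M.PosDef) (ψ : ℝ) :
    (act₂ (rot ψ) M).PosDef := by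
  have hU : IsUnit (rot ψ) := (Matrix.isUnit_iff_isUnit_det _).2 (by simp [rot_det])
  have := (Matrix.IsUnit.posDef_star_right_conjugate_iff (x := M) hU).2 hM
  simpa [act₂, Matrix.star_eq_conjTranspose, Matrix.conjTranspose_eq_transpose_of_trivial] using this

theorem posDef_diagForm (v w : ℝ) {A B C : ℝ} (hA : 0 < A) (hB : 0 < B) (hC : 0 < C) :
    (diagForm v w A B C).PosDef := by
  refine Matrix.PosDef.of_dotProduct_mulVec_pos ?_ fun x hx => ?_
  · ext i j
    fin_cases i <;> fin_cases j <;> simp [diagForm]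
  · have e : star x ⬝ᵥ (diagForm v w A B C).mulVec x
        = A * (x 0 - v * x 2) ^ 2 + B * (x 1 - w * x 2) ^ 2 + C * x 2 ^ 2 := by
      simp [diagForm, Matrix.mulVec, dotProduct, Fin.sum_univ_three]
      ring
    rw [e]
    by_contra hcon
    have h0 : 0 ≤ A * (x 0 - v * x 2) ^ 2 := by positivity
    have h1 : 0 ≤ B * (x 1 - w * x 2) ^ 2 := by positivity
    have h2 : 0 ≤ C * x 2 ^ 2 := by positivity
    have e2 : x 2 = 0 := by
      have : C * x 2 ^ 2 = 0 := by linarith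
      simpa [hC.ne'] using this
    have e0 : x 0 - v * x 2 = 0 := by
      have : A * (x 0 - v * x 2) ^ 2 = 0 := by linarith
      simpa [hA.ne'] using this
    have e1 : x 1 - w * x 2 = 0 := by
      have : B * (x 1 - w * x 2) ^ 2 = 0 := by linarith
      simpa [hB.ne'] using this
    refine hx (funext fun i => ?_)
    fin_cases i <;> simp <;> grind

theorem isRiemannianMetric_of_rot {g : Form} {M : Matrix (Fin 3) (Fin 3) ℝ} {φ : ℝ}
    (hg : ∀ p, g p = act₂ (rot (p 2 + φ)) M) (hM : M.PosDef) : IsRiemannianMetric g where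
  smooth i j := by
    have hrot : ∀ i a, ContDiff ℝ ∞ fun p : Pt => rot (p 2 + φ) i a := by
      intro i a
      fin_cases i <;> fin_cases a <;> simp [rot] <;> fun_prop
    simp only [hg, act₂_apply]
    exact ContDiff.sum fun a _ => (hrot i a).mul (ContDiff.sum fun b _ => (hrot j b).mul contDiff_const)
  posDef p := hg p ▸ posDef_act₂ hM _

/-- Every positive definite matrix is a rotated diagonal form. -/
theorem exists_diagForm {M : Matrix (Fin 3) (Fin 3) ℝ} (hM : M.PosDef) :
    ∃ φ v w A B C : ℝ, 0 < A ∧ 0 < B ∧ 0 < C ∧ M = act₂ (rot φ) (diagForm v w A B C) := by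
  obtain ⟨φ, hφ⟩ : ∃ φ : ℝ, M 0 1 * (Real.cos φ ^ 2 - Real.sin φ ^ 2)
      = (M 0 0 - M 1 1) * (Real.sin φ * Real.cos φ) := by
    -- The classical condition `tan 2φ = 2 M₀₁/(M₀₀ - M₁₁)`; taking half a complex argument also
    -- covers the degenerate cases.
    refine ⟨Complex.arg ⟨M 0 0 - M 1 1, 2 * M 0 1⟩ / 2, ?_⟩
    generalize hz : (⟨M 0 0 - M 1 1, 2 * M 0 1⟩ : ℂ) = z
    have h1 := Complex.norm_mul_cos_arg z
    have h2 := Complex.norm_mul_sin_arg z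
    rw [← Real.cos_two_mul', show Real.sin (z.arg / 2) * Real.cos (z.arg / 2)
      = Real.sin (2 * (z.arg / 2)) / 2 by rw [Real.sin_two_mul]; ring, mul_div_cancel₀ _ two_ne_zero]
    have h3 : M 0 0 - M 1 1 = z.re := by rw [← hz]
    have h4 : M 0 1 = z.im / 2 := by rw [← hz]; simp
    rw [h3, h4, ← h1, ← h2]
    ring
  have hN := posDef_act₂ hM (-φ)
  have hMN : M = act₂ (rot φ) (act₂ (rot (-φ)) M) := by
    rw [← act₂_rot_add, add_neg_cancel, rot_zero]
    simp [act₂]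
  have hMs : M 1 0 = M 0 1 := by simpa using hM.isHermitian.apply 0 1
  have h01 : act₂ (rot (-φ)) M 0 1 = 0 := by
    simp [act₂_apply, rot, Fin.sum_univ_three, hMs]
    linear_combination hφ
  generalize act₂ (rot (-φ)) M = N at hN hMN h01
  have hs : ∀ i j, N i j = N j i := fun i j => by simpa using hN.isHermitian.apply j i
  have hA := hN.diag_pos (i := 0)
  have hB := hN.diag_pos (i := 1)
  have e : N = diagForm (-(N 0 2 / N 0 0)) (-(N 1 2 / N 1 1)) (N 0 0) (N 1 1)
      (N 2 2 - N 0 2 ^ 2 / N 0 0 - N 1 2 ^ 2 / N 1 1) := by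
    ext i j
    fin_cases i <;> fin_cases j <;> simp [diagForm, h01, hs 1 0, hs 2 0, hs 2 1] <;> field_simp
    ring
  refine ⟨φ, _, _, _, _, _, hA, hB, ?_, e ▸ hMN⟩
  -- The last coefficient is a Schur complement; it is positive because the determinant is the
  -- product of the three coefficients.
  have hdet := hN.det_pos
  rw [e, diagForm_det] at hdet
  exact pos_of_mul_pos_right hdet (by positivity)

/-! ### Left-invariant vector fields and Milnor frames -/

theorem IsLeftInvariantField.eq_rot {X : Pt → Pt} (hX : IsLeftInvariantField X) (p : Pt) :
    X p = (rot (p 2)).mulVec (X 0) := by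
  have h := hX p 0
  rw [fderiv_mul, mul_zero_right] at h
  exact h.symm

theorem fderiv_rot_mulVec (φ : ℝ) (f p u : Pt) :
    fderiv ℝ (fun q : Pt => (rot (q 2 + φ)).mulVec f) p u
      = u 2 • (rot (p 2 + φ)).mulVec (gen.mulVec f) := by
  have h2 : HasFDerivAt (fun q : Pt => q 2 + φ)
      (ContinuousLinearMap.proj (R := ℝ) (φ := fun _ : Fin 3 => ℝ) 2) p :=
    (hasFDerivAt_apply (𝕜 := ℝ) (2 : Fin 3) p).add_const φ
  have h1 : HasDerivAt (fun s => (rot s).mulVec f) ((rot (p 2 + φ)).mulVec (gen.mulVec f))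
      (p 2 + φ) := by
    rw [hasDerivAt_pi]
    intro i
    have : HasDerivAt (fun s => ∑ a, rot s i a * f a) (∑ a, (rot (p 2 + φ) * gen) i a * f a)
        (p 2 + φ) := HasDerivAt.fun_sum fun a _ => (hasDerivAt_rot _ i a).mul_const _
    rw [Matrix.mulVec_mulVec]
    exact this
  have h := h1.hasFDerivAt.comp p h2
  rw [show (fun q : Pt => (rot (q 2 + φ)).mulVec f)
    = (fun s => (rot s).mulVec f) ∘ fun q : Pt => q 2 + φ from rfl, h.fderiv]
  simp

theorem lieBracket_rot_mulVec (φ : ℝ) (f h p : Pt) :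
    VectorField.lieBracket ℝ (fun q : Pt => (rot (q 2 + φ)).mulVec f)
      (fun q : Pt => (rot (q 2 + φ)).mulVec h) p
      = (rot (p 2 + φ)).mulVec (f 2 • gen.mulVec h - h 2 • gen.mulVec f) := by
  have h2 : ∀ f : Pt, (rot (p 2 + φ)).mulVec f 2 = f 2 := fun f => by
    simp [rot, Matrix.mulVec, dotProduct, Fin.sum_univ_three]
  simp only [VectorField.lieBracket_eq, fderiv_rot_mulVec, h2, Matrix.mulVec_sub, Matrix.mulVec_smul]

/-- The standard Milnor frame of a rotated diagonal form, at angle zero. -/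
def milnorBase (v w : ℝ) : Fin 3 → Pt := ![![1, 0, 0], ![0, 1, 0], ![-2 * v, -2 * w, -2]]

/-- The factor `-2` in the third frame vector normalises the brackets, and its square turns the
coefficient `C` into `4 * C`. -/
theorem isMilnorFrame_of_rot {g : Form} {v w A B C φ : ℝ} (hA : 0 < A) (hB : 0 < B) (hC : 0 < C)
    (hg : ∀ p, g p = act₂ (rot (p 2 + φ)) (diagForm v w A B C)) :
    IsMilnorFrame g (fun i p => (rot (p 2 + φ)).mulVec (milnorBase v w i)) A B (4 * C) where
  leftInvariant i a p := by
    have h2 : mul a p 2 = a 2 + p 2 := by simp [mul]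
    simp only [fderiv_mul, Matrix.mulVec_mulVec, ← rot_add, ← add_assoc, h2]
  bracket_23 p := by
    rw [lieBracket_rot_mulVec, ← Matrix.mulVec_smul _ (-2 : ℝ)]
    congr 1
    funext i
    fin_cases i <;> simp [milnorBase, gen]
  bracket_31 p := by
    rw [lieBracket_rot_mulVec, ← Matrix.mulVec_smul _ (-2 : ℝ)]
    congr 1
    funext i
    fin_cases i <;> simp [milnorBase, gen]
  bracket_12 p := by
    rw [lieBracket_rot_mulVec]
    simp [milnorBase]
  linearIndependent p := by
    have h : LinearIndependent ℝ (milnorBase v w) := by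
      have : LinearIndependent ℝ (Matrix.of (milnorBase v w)).row := by
        rw [Matrix.linearIndependent_rows_iff_isUnit, Matrix.isUnit_iff_isUnit_det]
        simp [milnorBase, Matrix.det_fin_three]
      exact this
    have hinj : Function.Injective (rot (p 2 + φ)).mulVec := by
      rw [Matrix.mulVec_injective_iff_isUnit, Matrix.isUnit_iff_isUnit_det]
      simp [rot_det]
    exact h.map' (Matrix.mulVecLin (rot (p 2 + φ))) (LinearMap.ker_eq_bot.2 hinj)
  pos := ⟨hA, hB, by positivity⟩
  diagonal p i j := by
    rw [app_rot hg]
    fin_cases i <;> fin_cases j <;>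
      simp [milnorBase, diagForm, Matrix.mulVec, dotProduct, Fin.sum_univ_three] <;> ring

/-- Whether the first two coefficients agree does not depend on the Milnor frame. -/
theorem IsMilnorFrame.eq_iff {g : Form} {v w A B C φ : ℝ} {F : Fin 3 → Pt → Pt} {A₀ B₀ C₀ : ℝ}
    (hF : IsMilnorFrame g F A₀ B₀ C₀)
    (hg : ∀ p, g p = act₂ (rot (p 2 + φ)) (diagForm v w A B C)) : A₀ = B₀ ↔ A = B := by
  obtain ⟨f, hf⟩ : ∃ f : Fin 3 → Pt, ∀ i, F i = fun p => (rot (p 2 + φ)).mulVec (f i) := by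
    refine ⟨fun i => (rot (-φ)).mulVec (F i 0), fun i => funext fun p => ?_⟩
    rw [Matrix.mulVec_mulVec, ← rot_add, add_neg_cancel_right]
    exact (hF.leftInvariant i).eq_rot p
  have hinj : ∀ p : Pt, Function.Injective (rot (p 2 + φ)).mulVec := fun p => by
    rw [Matrix.mulVec_injective_iff_isUnit, Matrix.isUnit_iff_isUnit_det]
    simp [rot_det]
  have h23 := hF.bracket_23 0
  have h31 := hF.bracket_31 0
  have hne := (hF.linearIndependent 0).ne_zero 0
  have d00 := hF.diagonal 0 0 0
  have d11 := hF.diagonal 0 1 1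
  have d01 := hF.diagonal 0 0 1
  simp only [hf] at h23 h31 hne d00 d11 d01
  rw [lieBracket_rot_mulVec, ← Matrix.mulVec_smul _ (-2 : ℝ)] at h23 h31
  rw [app_rot hg] at d00 d11 d01
  have k23 := hinj 0 h23
  have k31 := hinj 0 h31
  have a0 := congrFun k23 0
  have a1 := congrFun k23 1
  have a2 := congrFun k23 2
  have b0 := congrFun k31 0
  have b1 := congrFun k31 1
  have b2 := congrFun k31 2
  simp [gen, dotProduct, Fin.sum_univ_three] at a0 a1 a2 b0 b1 b2
  simp [diagForm, Matrix.mulVec, dotProduct, Fin.sum_univ_three] at d00 d11 d01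
  have hx : f 0 0 ≠ 0 ∨ f 0 1 ≠ 0 := by
    by_contra! hcon
    apply hne
    have : f 0 = 0 := by
      funext i
      fin_cases i <;> simp [hcon, a2]
    rw [this, Matrix.mulVec_zero]
  simp only [a2, b2, zero_mul, mul_zero, neg_zero, add_zero, zero_add, sub_zero, zero_sub]
    at a0 a1 b0 b1 d00 d11 d01
  generalize f 0 0 = x at *
  generalize f 0 1 = y at *
  generalize f 2 2 = c at *
  -- The first two frame vectors are horizontal, being multiples of brackets. The second is the
  -- first turned by a right angle and scaled by `c/2`, where the brackets force `c² = 4`. If `A ≠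
  -- B`, orthogonality then gives `xy = 0`, and `A₀ = B₀` would give `x² = y²`, contradicting `hx`.
  have e0 : f 1 0 = c * y / 2 := by linarith
  have e1 : f 1 1 = -(c * x / 2) := by linarith
  rw [e0, e1] at d11 d01
  rw [e0] at a1
  rw [e1] at a0
  have hc : c ^ 2 = 4 := by
    rcases hx with hx | hx
    · refine mul_left_cancel₀ hx ?_
      linear_combination (-2) * a0
    · refine mul_left_cancel₀ hx ?_
      linear_combination (-2) * a1
  have hdiff : A₀ - B₀ = (A - B) * (x ^ 2 - y ^ 2) := by
    rw [← d00, ← d11]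
    linear_combination (-(A * y ^ 2 + B * x ^ 2) / 4) * hc
  have hcross : (A - B) * (x * y) = 0 := by
    have : c ≠ 0 := by
      rintro rfl
      norm_num at hc
    refine mul_left_cancel₀ this ?_
    linear_combination 2 * d01
  constructor
  · intro h
    by_contra hAB
    have hAB' : A - B ≠ 0 := sub_ne_zero.2 hAB
    have h1 : x * y = 0 := (mul_eq_zero.1 hcross).resolve_left hAB'
    have h2 : x ^ 2 - y ^ 2 = 0 := by
      rw [h, sub_self] at hdiff
      exact (mul_eq_zero.1 hdiff.symm).resolve_left hAB'
    rcases mul_eq_zero.1 h1 with h0 | h0 <;> simp [h0] at h2 hx <;> exact hx h2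
  · intro h
    rw [h, sub_self, zero_mul] at hdiff
    exact sub_eq_zero.1 hdiff

/-! ### Uniqueness of the left-invariant flow -/

theorem contDiffAt_inv_apply {N : Fin 3 → Fin 3 → ℝ} (hN : (Matrix.of N).det ≠ 0) (k l : Fin 3) :
    ContDiffAt ℝ 1 (fun N : Fin 3 → Fin 3 → ℝ => (Matrix.of N)⁻¹ k l) N := by
  have hdet : ContDiff ℝ 1 fun N : Fin 3 → Fin 3 → ℝ => (Matrix.of N).det := by
    simp only [Matrix.det_fin_three, Matrix.of_apply]
    fun_prop
  have hadj : ContDiff ℝ 1 fun N : Fin 3 → Fin 3 → ℝ => (Matrix.of N).adjugate k l := by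
    simp only [Matrix.adjugate_fin_three, Matrix.of_apply]
    fin_cases k <;> fin_cases l <;> simp <;> fun_prop
  simp only [Matrix.inv_def, Ring.inverse_eq_inv', Matrix.smul_apply, smul_eq_mul]
  exact (hdet.contDiffAt.inv hN).mul hadj.contDiffAt

theorem contDiffAt_christBase {N : Fin 3 → Fin 3 → ℝ} (hN : (Matrix.of N).det ≠ 0)
    (k i j : Fin 3) :
    ContDiffAt ℝ 1 (fun N : Fin 3 → Fin 3 → ℝ => christBase (Matrix.of N) k i j) N := by
  have hgrad : ∀ l i j, ContDiff ℝ 1 fun N : Fin 3 → Fin 3 → ℝ => grad₂ (Matrix.of N) l i j := by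
    intro l i j
    by_cases hl : l = 2
    · simp only [grad₂, hl, if_true, ang₂, Matrix.sub_apply, Matrix.mul_apply, Matrix.of_apply]
      fun_prop
    · simp only [grad₂, hl, if_false]
      fun_prop
  unfold christBase
  exact contDiffAt_const.mul (ContDiffAt.sum fun l _ => (contDiffAt_inv_apply hN k l).mul
    (((hgrad i j l).add (hgrad j i l)).sub (hgrad l i j)).contDiffAt)

/-- Ricci is rational in the entries of the metric, with denominators powers of the determinant.
This supplies the local Lipschitz bound for uniqueness. -/
theorem contDiffAt_ricBase {N : Fin 3 → Fin 3 → ℝ} (hN : (Matrix.of N).det ≠ 0) :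
    ContDiffAt ℝ 1 (fun (N : Fin 3 → Fin 3 → ℝ) (i j : Fin 3) => -2 * ricBase (Matrix.of N) i j)
      N := by
  have hΓ := fun k i j => contDiffAt_christBase hN k i j
  have hang : ∀ k i j, ContDiffAt ℝ 1
      (fun N : Fin 3 → Fin 3 → ℝ => ang₃ (christBase (Matrix.of N)) k i j) N := by
    intro k i j
    unfold ang₃
    exact ((ContDiffAt.sum fun a _ => contDiffAt_const.mul (hΓ _ _ _)).add
      (ContDiffAt.sum fun a _ => contDiffAt_const.mul (hΓ _ _ _))).add
      (ContDiffAt.sum fun a _ => contDiffAt_const.mul (hΓ _ _ _))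
  refine contDiffAt_pi.2 fun i => contDiffAt_pi.2 fun j => contDiffAt_const.mul ?_
  simp only [ricBase, Matrix.of_apply]
  refine ((hang 2 i j).sub ?_).add (ContDiffAt.sum fun a _ => ContDiffAt.sum fun m _ =>
    ((hΓ _ _ _).mul (hΓ _ _ _)).sub ((hΓ _ _ _).mul (hΓ _ _ _)))
  by_cases hi : i = 2
  · simp only [hi, if_true]
    exact ContDiffAt.sum fun a _ => hang a a j
  · simp only [hi, if_false]
    exact contDiffAt_const

theorem IsRicciFlowOn.mono {I J : Set ℝ} {g : ℝ → Form} (hg : IsRicciFlowOn J g) (h : I ⊆ J) :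
    IsRicciFlowOn I g where
  metric t ht := hg.metric t (h ht)
  evolution t ht p i j := (hg.evolution t (h ht) p i j).mono h

/-- Left-invariance turns the flow into an autonomous ODE for the matrix at the origin. -/
theorem IsRicciFlowOn.hasDerivWithinAt_base {I : Set ℝ} {g : ℝ → Form} (hg : IsRicciFlowOn I g)
    (hinv : ∀ t ∈ I, IsLeftInvariant (g t)) {t : ℝ} (ht : t ∈ I) :
    HasDerivWithinAt (fun s i j => g s 0 i j)
      (fun i j => -2 * ricBase (Matrix.of fun i j => g t 0 i j) i j) I t := by
  refine hasDerivWithinAt_pi.2 fun i => hasDerivWithinAt_pi.2 fun j => ?_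
  have h := hg.evolution t ht 0 i j
  have hrot : ∀ p, g t p = act₂ (rot (p 2 + 0)) (g t 0) := fun p => by
    rw [add_zero]
    exact (hinv t ht).eq_rot p
  have hric : ricci (g t) 0 = ricBase (g t 0) := by
    rw [ricci_rot hrot]
    simp [rot_zero, act₂]
  rw [hric] at h
  exact h

theorem ricciFlow_unique {T : ℝ} {g g' : ℝ → Form} (h0 : g 0 = g' 0)
    (hg : IsRicciFlowOn (Ico 0 T) g) (hg' : IsRicciFlowOn (Ico 0 T) g')
    (hinv : ∀ t ∈ Ico 0 T, IsLeftInvariant (g t)) (hinv' : ∀ t ∈ Ico 0 T, IsLeftInvariant (g' t))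
    {t : ℝ} (ht : t ∈ Ico 0 T) : g t = g' t := by
  have hsub : Icc 0 t ⊆ Ico 0 T := fun s hs => ⟨hs.1, hs.2.trans_lt ht.2⟩
  have hcont : ∀ {h : ℝ → Form}, IsRicciFlowOn (Ico 0 T) h →
      (∀ t ∈ Ico 0 T, IsLeftInvariant (h t)) →
      ContinuousOn (fun s i j => h s 0 i j) (Icc 0 t) := fun hh hi s hs =>
    ((hh.hasDerivWithinAt_base hi (hsub hs)).continuousWithinAt).mono hsub
  have hder : ∀ {h : ℝ → Form}, IsRicciFlowOn (Ico 0 T) h →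
      (∀ t ∈ Ico 0 T, IsLeftInvariant (h t)) → ∀ s ∈ Ico 0 t,
      HasDerivWithinAt (fun s i j => h s 0 i j)
        (fun i j => -2 * ricBase (Matrix.of fun i j => h s 0 i j) i j) (Ici s) s := by
    intro h hh hi s hs
    refine (hh.hasDerivWithinAt_base hi (hsub ⟨hs.1, hs.2.le⟩)).mono_of_mem_nhdsWithin ?_
    filter_upwards [self_mem_nhdsWithin,
      mem_nhdsWithin_of_mem_nhds (Iio_mem_nhds (hs.2.trans ht.2))] with r hr hr'
    exact ⟨hs.1.trans hr, hr'⟩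
  -- The union of the two trajectories over `[0, t]` is compact and consists of invertible matrices,
  -- so local Lipschitz bounds become a uniform one on it; no convexity is needed.
  have hcpt := (isCompact_Icc.image_of_continuousOn (hcont hg hinv)).union
    (isCompact_Icc.image_of_continuousOn (hcont hg' hinv'))
  obtain ⟨K, hK⟩ := LocallyLipschitzOn.exists_lipschitzOnWith_of_compact hcpt
    (f := fun (N : Fin 3 → Fin 3 → ℝ) (i j : Fin 3) => -2 * ricBase (Matrix.of N) i j) (by
      intro N hN
      have hdet : (Matrix.of N).det ≠ 0 := by
        rcases hN with ⟨s, hs, rfl⟩ | ⟨s, hs, rfl⟩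
        · exact ((hg.metric s (hsub hs)).posDef 0).det_pos.ne'
        · exact ((hg'.metric s (hsub hs)).posDef 0).det_pos.ne'
      obtain ⟨K, U, hU, hK⟩ := (contDiffAt_ricBase hdet).exists_lipschitzOnWith
      exact ⟨K, U, mem_nhdsWithin_of_mem_nhds hU, hK⟩)
  have huniq := ODE_solution_unique_of_mem_Icc_right
    (v := fun _ (N : Fin 3 → Fin 3 → ℝ) (i j : Fin 3) => -2 * ricBase (Matrix.of N) i j)
    (s := fun _ => _) (fun _ _ => hK) (hcont hg hinv) (hder hg hinv)
    (fun s hs => Or.inl ⟨s, ⟨hs.1, hs.2.le⟩, rfl⟩) (hcont hg' hinv') (hder hg' hinv')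
    (fun s hs => Or.inr ⟨s, ⟨hs.1, hs.2.le⟩, rfl⟩) (by simp only [h0])
  have hbase : g t 0 = g' t 0 := by
    ext i j
    exact congrFun (congrFun (huniq ⟨ht.1, le_rfl⟩) i) j
  funext p
  rw [(hinv t ht).eq_rot p, (hinv' t ht).eq_rot p, hbase]

/-! ### Existence of the flow and decay of the Cotton-York tensor -/

/-- Linearity in the three coefficients lets each matrix entry be differentiated in time with `v`,
`w` and the rotation fixed. -/
theorem act₂_diagForm (Q : Matrix (Fin 3) (Fin 3) ℝ) (v w A B C : ℝ) (i j : Fin 3) :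
    act₂ Q (diagForm v w A B C) i j = A * act₂ Q (diagForm v w 1 0 0) i j
      + B * act₂ Q (diagForm v w 0 1 0) i j + C * act₂ Q (diagForm v w 0 0 1) i j := by
  simp [act₂_apply, diagForm, Fin.sum_univ_three]
  ring

theorem IsCoefficientFlow.isRicciFlowOn {a b c : ℝ → ℝ} (h : IsCoefficientFlow a b c)
    (φ v w : ℝ) :
    IsRicciFlowOn (Ici 0) fun t p => act₂ (rot (p 2 + φ)) (diagForm v w (a t) (b t) (c t)) where
  metric t ht := by
    obtain ⟨ha, hb, hc⟩ := h.pos t ht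
    exact isRiemannianMetric_of_rot (fun _ => rfl) (posDef_diagForm v w ha hb hc)
  evolution t ht p i j := by
    obtain ⟨ha, hb, hc⟩ := h.pos t ht
    rw [ricci_rot (fun _ => rfl), ricBase_diagForm v w ha.ne' hb.ne' hc.ne']
    simp only [act₂_diagForm _ v w (a _), act₂_diagForm _ v w (_ / _)]
    refine HasDerivAt.hasDerivWithinAt ?_
    refine ((((h.deriv_a t ht).mul_const _).add ((h.deriv_b t ht).mul_const _)).add
      ((h.deriv_c t ht).mul_const _)).congr_deriv ?_
    ring

theorem exists_coefficientFlow {A B C : ℝ} (hA : 0 < A) (hB : 0 < B) (hC : 0 < C) :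
    ∃ a b c : ℝ → ℝ, IsCoefficientFlow a b c ∧ a 0 = A ∧ b 0 = B ∧ c 0 = C ∧
      (A ≠ B → StrictAntiOn (fun t => Real.sqrt (density (a t) (b t) (c t))) (Ici 0) ∧
        Tendsto (fun t => Real.sqrt (density (a t) (b t) (c t))) atTop (𝓝 0)) ∧
      (A = B → ∀ t, density (a t) (b t) (c t) = 0) := by
  by_cases hAB : A = B
  · subst hAB
    exact ⟨_, _, _, isCoefficientFlow_const hA hC, rfl, rfl, rfl, fun h => (h rfl).elim,
      fun _ t => by simp [density]⟩
  · obtain ⟨k, κ, y, σ, hk, hκ, hy, hσ, h1, h2, h3⟩ := exists_param hA hB hC hAB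
    have hd := fun t (ht : 0 ≤ t) => density_param (y := param κ y t) hk hκ (param_pos hκ hy ht) hσ
    refine ⟨_, _, _, isCoefficientFlow_param hk hκ hy hσ, by simpa [param_zero] using h1,
      by simpa [param_zero] using h2, by simpa [param_zero] using h3, fun _ => ⟨?_, ?_⟩,
      fun h => (hAB h).elim⟩
    · intro s hs t ht hst
      have hs' := param_pos hκ hy hs
      have ht' := param_pos hκ hy ht
      have hss := Real.sinh_pos_iff.2 hs'
      have hlt : Real.sinh (param κ y s) < Real.sinh (param κ y t) :=
        Real.sinh_lt_sinh.2 (strictMono_param hκ y hst)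
      have hq : (Real.sinh (param κ y t) ^ 2)⁻¹ < (Real.sinh (param κ y s) ^ 2)⁻¹ := by gcongr
      simp only [hd s hs, hd t ht]
      refine Real.sqrt_lt_sqrt (by positivity) (mul_lt_mul_of_pos_left ?_ (by positivity))
      exact strictMonoOn_density_polynomial (mem_Ici.2 (by positivity)) (mem_Ici.2 (by positivity)) hq
    -- From `y ≤ sinh y` and `y → ∞`, the variable `q = 1/sinh² y` tends to `0`, where the density
    -- vanishes.
    · have hsinh : Tendsto (fun t => Real.sinh (param κ y t)) atTop atTop :=
        tendsto_atTop_mono' _ ((eventually_ge_atTop 0).mono fun t ht =>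
          (Real.self_le_sinh_iff.2 (param_pos hκ hy ht).le)) (tendsto_param hκ y)
      have hq : Tendsto (fun t => (Real.sinh (param κ y t) ^ 2)⁻¹) atTop (𝓝 0) :=
        tendsto_inv_atTop_zero.comp ((tendsto_pow_atTop two_ne_zero).comp hsinh)
      have hcont : Continuous fun q : ℝ =>
          Real.sqrt (8 * k ^ 2 / κ ^ 2 * (q * (1 + q) * (12 * q ^ 2 + 15 * q + 4))) := by fun_prop
      have hlim := (hcont.tendsto 0).comp hq
      simp only [zero_mul, mul_zero, Real.sqrt_zero] at hlim
      refine hlim.congr' ((eventually_ge_atTop 0).mono fun t ht => ?_)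
      simp only [Function.comp, hd t ht]

end CottonFlow

end

theorem theorem3p4 (g₀ : CottonFlow.Form)
    (hg₀ : CottonFlow.IsRiemannianMetric g₀) (hinv : CottonFlow.IsLeftInvariant g₀) :
    -- a Milnor frame for the initial metric exists
    (∃ (F : Fin 3 → CottonFlow.Pt → CottonFlow.Pt) (A₀ B₀ C₀ : ℝ),
      CottonFlow.IsMilnorFrame g₀ F A₀ B₀ C₀) ∧
    -- the left-invariant Ricci flow from `g₀` exists for all time and is unique
    ∃ g : ℝ → CottonFlow.Form,
      g 0 = g₀ ∧ CottonFlow.IsRicciFlowOn (Set.Ici 0) g ∧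
      (∀ t, 0 ≤ t → CottonFlow.IsLeftInvariant (g t)) ∧
      (∀ (T : ℝ) (g' : ℝ → CottonFlow.Form), 0 < T → g' 0 = g₀ →
        CottonFlow.IsRicciFlowOn (Set.Ico 0 T) g' →
        (∀ t ∈ Set.Ico 0 T, CottonFlow.IsLeftInvariant (g' t)) →
        ∀ t ∈ Set.Ico 0 T, g' t = g t) ∧
      -- the behaviour of the `L¹`-norm of the Cotton-York tensor
      ∀ (F : Fin 3 → CottonFlow.Pt → CottonFlow.Pt) (A₀ B₀ C₀ : ℝ),
        CottonFlow.IsMilnorFrame g₀ F A₀ B₀ C₀ →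
        ∀ K : Set CottonFlow.Pt, IsCompact K →
          (A₀ ≠ B₀ →
            (0 < MeasureTheory.volume K →
              StrictAntiOn (fun t => CottonFlow.cottonYorkL1 K (g t)) (Set.Ici 0)) ∧
            Filter.Tendsto (fun t => CottonFlow.cottonYorkL1 K (g t)) Filter.atTop (nhds 0)) ∧
          (A₀ = B₀ → ∀ t, 0 ≤ t → CottonFlow.cottonYorkL1 K (g t) = 0) := by
  obtain ⟨φ, v, w, A, B, C, hA, hB, hC, hM⟩ := CottonFlow.exists_diagForm (hg₀.posDef 0)
  have hrot : ∀ p, g₀ p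
      = CottonFlow.act₂ (CottonFlow.rot (p 2 + φ)) (CottonFlow.diagForm v w A B C) := fun p => by
    rw [hinv.eq_rot p, hM, ← CottonFlow.act₂_rot_add]
  obtain ⟨a, b, c, hflow, ha, hb, hc, hne, heq⟩ := CottonFlow.exists_coefficientFlow hA hB hC
  have hL1 : ∀ (K : Set CottonFlow.Pt) (t : ℝ), 0 ≤ t → CottonFlow.cottonYorkL1 K
      (fun p => CottonFlow.act₂ (CottonFlow.rot (p 2 + φ))
        (CottonFlow.diagForm v w (a t) (b t) (c t)))
      = (MeasureTheory.volume K).toReal * Real.sqrt (CottonFlow.density (a t) (b t) (c t)) := by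
    intro K t ht
    obtain ⟨h1, h2, h3⟩ := hflow.pos t ht
    exact CottonFlow.cottonYorkL1_eq h1 h2 h3 (fun _ => rfl) K
  have hzero : (fun p : CottonFlow.Pt => CottonFlow.act₂ (CottonFlow.rot (p 2 + φ))
      (CottonFlow.diagForm v w (a 0) (b 0) (c 0))) = g₀ := by
    funext p
    rw [ha, hb, hc, hrot]
  have hleft : ∀ t, CottonFlow.IsLeftInvariant fun p => CottonFlow.act₂ (CottonFlow.rot (p 2 + φ))
      (CottonFlow.diagForm v w (a t) (b t) (c t)) := fun t =>
    CottonFlow.isLeftInvariant_of_rot fun _ => rfl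
  refine ⟨⟨_, _, _, _, CottonFlow.isMilnorFrame_of_rot hA hB hC hrot⟩,
    fun t p => CottonFlow.act₂ (CottonFlow.rot (p 2 + φ))
      (CottonFlow.diagForm v w (a t) (b t) (c t)),
    hzero, hflow.isRicciFlowOn φ v w, fun t _ => hleft t, ?_, ?_⟩
  · intro T g' _ h0 hg' hinv' t ht
    exact CottonFlow.ricciFlow_unique (h0.trans hzero.symm) hg'
      ((hflow.isRicciFlowOn φ v w).mono Set.Ico_subset_Ici_self) hinv' (fun s _ => hleft s) ht
  · intro F A₀ B₀ C₀ hF K hK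
    have hiff := hF.eq_iff hrot
    refine ⟨fun hAB => ?_, fun hAB t ht => ?_⟩
    · obtain ⟨hanti, hlim⟩ := hne (mt hiff.2 hAB)
      refine ⟨fun hpos s hs t ht hst => ?_, ?_⟩
      -- Compactness makes the volume finite; otherwise `toReal` would return `0` and strictness
      -- would be lost.
      · have hvol : 0 < (MeasureTheory.volume K).toReal :=
          ENNReal.toReal_pos hpos.ne' hK.measure_lt_top.ne
        simp only [hL1 K s hs, hL1 K t ht]
        exact mul_lt_mul_of_pos_left (hanti hs ht hst) hvol
      · have h := hlim.const_mul (MeasureTheory.volume K).toReal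
        rw [mul_zero] at h
        exact h.congr' ((Filter.eventually_ge_atTop 0).mono fun t ht => (hL1 K t ht).symm)
    · rw [hL1 K t ht, heq (hiff.1 hAB) t, Real.sqrt_zero, mul_zero]
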